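/- Let $G\subset GL(n,\mathbb C)$ be a Zariski closed subgroup that is stable under conjugate transpose $g\mapsto g^*$ (so $G$ is reductive), let $K=G\cap U(n)$, and let $V=\mathbb C^n$ with its standard Hermitian inner product $\langle\cdot,\cdot\rangle$ (linear in the first argument). Let $X\subset V$ be an irreducible, Zariski closed, $G$-invariant subset, and let $X_{reg}$ be its set of smooth points. Put $$d_1(X)=\max_{x\in X}\dim_{\mathbb C} Gx,\qquad d(X)=\max\{\dim_{\mathbb C} Gx : x\in X,\ Gx \text{ closed}\},$$ $$\mathrm{Crit}(X)=\{x\in X : \langle Ax,x\rangle=0 \text{ for all } A\in Lie(G)\},\qquad \mathrm{Crit}^o(X)=\{x\in \mathrm{Crit}(X) : \dim_{\mathbb R}Kx=d(X)\}.$$ Assume that $d(X)=d_1(X)$ and write $d=d(X)$. Then: 1. $\mathrm{Crit}^o(X)\cap X_{reg}$ is an embedded smooth real submanifold of $X_{reg}$ (itself a real submanifold of $V$ of dimension $2\dim_{\mathbb C}X$), of real dimension $2\dim_{\mathbb C} X-d$. 2. It is cut out locally by moment-map components. For $A\in Lie(K)$ let $g_A(x)=\frac{1}{2i}\langle Ax,x\rangle\in\mathbb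 R$. For every $v\in \mathrm{Crit}^o(X)\cap X_{reg}$ there are $A_1,\dots,A_d\in Lie(K)$ with $A_1v,\dots,A_dv$ linearly independent over $\mathbb R$; and for every such $A_1,\dots,A_d$ there is an open neighbourhood $U$ of $v$ in $V$ such that $$\mathrm{Crit}^o(X)\cap X_{reg}\cap U=\{u\in X_{reg}\cap U : g_{A_1}(u)=\dots=g_{A_d}(u)=0\},$$ and for every $u$ in this set the restrictions to $T_u(X)$ of the differentials $(dg_{A_1})_u,\dots,(dg_{A_d})_u$ are linearly independent over $\mathbb R$. -/

import Mathlib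

open scoped ContDiff Matrix

noncomputable section

namespace KempfNess

/-- The space `ℂⁿ` with its standard Hermitian inner product. -/
abbrev V (n : ℕ) : Type := EuclideanSpace ℂ (Fin n)

/-- The linear action of an `n × n` matrix on `ℂⁿ`. -/
def act {n : ℕ} (A : Matrix (Fin n) (Fin n) ℂ) (x : V n) : V n :=
  Matrix.toEuclideanLin A x

/-! ### Algebraic sets in `ℂⁿ` -/

section Algebraic

variable {n : ℕ}

/-- The ideal of all polynomials that vanish on `X`. -/
def idealOf (X : Set (V n)) : Ideal (MvPolynomial (Fin n) ℂ) :=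
  MvPolynomial.vanishingIdeal ℂ (WithLp.ofLp '' X)

/-- `X` is the set of common zeros of some set of polynomials. -/
def IsZariskiClosed (X : Set (V n)) : Prop :=
  ∃ S : Set (MvPolynomial (Fin n) ℂ), X = {x | ∀ p ∈ S, MvPolynomial.eval x.ofLp p = 0}

/-- `X` is an irreducible (in particular non-empty) Zariski closed subset of `ℂⁿ`. -/
def IsIrreducibleVariety (X : Set (V n)) : Prop :=
  IsZariskiClosed X ∧ (idealOf X).IsPrime

/-- The complex dimension of an irreducible variety: the transcendence degree over `ℂ` of its
coordinate ring (equivalently, of its function field).  It is at most `n`, so that `toNat`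
loses nothing. -/
def dimension (X : Set (V n)) : ℕ :=
  (Algebra.trdeg ℂ (MvPolynomial (Fin n) ℂ ⧸ idealOf X)).toNat

/-- The Zariski tangent space `T_x(X) = {w | (dp)_x(w) = 0 for all p in the ideal of X}`,
as a complex subspace of `ℂⁿ`. -/
def tangentSpace (X : Set (V n)) (x : V n) : Submodule ℂ (V n) where
  carrier := {w | ∀ p ∈ idealOf X,
    ∑ i, MvPolynomial.eval x.ofLp (MvPolynomial.pderiv i p) * w i = 0}
  zero_mem' := by
    intro p _
    simp
  add_mem' := by
    intro a b ha hb p hp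
    have h1 := ha p hp
    have h2 := hb p hp
    simp only [PiLp.add_apply, mul_add, Finset.sum_add_distrib, h1, h2, add_zero]
  smul_mem' := by
    intro c a ha p hp
    have h1 := ha p hp
    simp only [PiLp.smul_apply, smul_eq_mul, mul_left_comm _ c, ← Finset.mul_sum, h1, mul_zero]

/-- `X_reg`, the set of smooth points of the irreducible variety `X`. -/
def smoothPoints (X : Set (V n)) : Set (V n) :=
  {x | x ∈ X ∧ Module.finrank ℂ (tangentSpace X x) = dimension X}

end Algebraic

/-! ### Linear groups, their Lie algebras and orbits -/

section Groups

variable {n : ℕ}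

/-- `G` is Zariski closed in `GL(n, ℂ)`. -/
def IsZariskiClosedSubgroup (G : Subgroup (GL (Fin n) ℂ)) : Prop :=
  ∃ S : Set (MvPolynomial (Fin n × Fin n) ℂ), ∀ g : GL (Fin n) ℂ,
    g ∈ G ↔ ∀ p ∈ S, MvPolynomial.eval (fun ij => g.val ij.1 ij.2) p = 0

/-- `G` is stable under conjugate transpose. -/
def IsSelfAdjointSubgroup (G : Subgroup (GL (Fin n) ℂ)) : Prop :=
  ∀ g ∈ G, ∃ h ∈ G, h.val = (g.val)ᴴ

/-- `K = G ∩ U(n)`. -/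
def compactPart (G : Subgroup (GL (Fin n) ℂ)) : Subgroup (GL (Fin n) ℂ) where
  carrier := {g | g ∈ G ∧ g.val ∈ Matrix.unitaryGroup (Fin n) ℂ}
  one_mem' := ⟨G.one_mem, one_mem _⟩
  mul_mem' := by
    rintro a b ⟨ha, ha'⟩ ⟨hb, hb'⟩
    exact ⟨G.mul_mem ha hb, mul_mem ha' hb'⟩
  inv_mem' := by
    rintro a ⟨ha, ha'⟩
    refine ⟨G.inv_mem ha, ?_⟩
    have h : (a⁻¹).val = star a.val := by
      have h1 : star a.val * a.val = 1 := Matrix.mem_unitaryGroup_iff'.1 ha'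
      calc (a⁻¹).val = (star a.val * a.val) * (a⁻¹).val := by rw [h1, one_mul]
        _ = star a.val := by rw [mul_assoc, Units.mul_inv, mul_one]
    change (a⁻¹).val ∈ _
    rw [h]
    exact Unitary.star_mem ha'

/-- The Lie algebra of a closed linear group `H`: all matrices `A` with `exp(tA) ∈ H` for every
real `t`. -/
def lieAlg (H : Subgroup (GL (Fin n) ℂ)) : Set (Matrix (Fin n) (Fin n) ℂ) :=
  {A | ∀ t : ℝ, ∃ h ∈ H, h.val = NormedSpace.exp (t • A)}

/-- The orbit `H x`. -/
def orbit (H : Subgroup (GL (Fin n) ℂ)) (x : V n) : Set (V n) :=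
  {y | ∃ h ∈ H, y = act h.val x}

/-- The tangent space `Lie(H) x` at `x` of the orbit `H x`.  For a closed real Lie group
(`𝕜 = ℝ`), and for a Zariski closed complex group (`𝕜 = ℂ`), the vectors `A x` with
`A ∈ Lie(H)` already form a `𝕜`-subspace. -/
def orbitTangent (𝕜 : Type) [Field 𝕜] [Module 𝕜 (V n)] (H : Subgroup (GL (Fin n) ℂ))
    (x : V n) : Submodule 𝕜 (V n) :=
  Submodule.span 𝕜 {y | ∃ A ∈ lieAlg H, y = act A x}

/-- The dimension over `𝕜` of the orbit `H x`: complex for `𝕜 = ℂ`, real for `𝕜 = ℝ`. -/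
def orbitDim (𝕜 : Type) [Field 𝕜] [Module 𝕜 (V n)] (H : Subgroup (GL (Fin n) ℂ))
    (x : V n) : ℕ :=
  Module.finrank 𝕜 (orbitTangent 𝕜 H x)

/-- `d(X)`, the maximal complex dimension of a closed `G`-orbit in `X`. -/
def maxClosedOrbitDim (G : Subgroup (GL (Fin n) ℂ)) (X : Set (V n)) : ℕ :=
  sSup {k | ∃ x ∈ X, IsClosed (orbit G x) ∧ k = orbitDim ℂ G x}

/-- `d₁(X)`, the maximal complex dimension of a `G`-orbit in `X`. -/
def maxOrbitDim (G : Subgroup (GL (Fin n) ℂ)) (X : Set (V n)) : ℕ :=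
  sSup {k | ∃ x ∈ X, k = orbitDim ℂ G x}

/-- `Crit(X)`: the points `x ∈ X` with `⟨A x, x⟩ = 0` for all `A ∈ Lie(G)`. -/
def crit (G : Subgroup (GL (Fin n) ℂ)) (X : Set (V n)) : Set (V n) :=
  {x | x ∈ X ∧ ∀ A ∈ lieAlg G, inner ℂ (act A x) x = 0}

/-- `Critᵒ(X)`: the points of `Crit(X)` whose `K`-orbit has real dimension `d(X)`. -/
def critO (G : Subgroup (GL (Fin n) ℂ)) (X : Set (V n)) : Set (V n) :=
  {x | x ∈ crit G X ∧ orbitDim ℝ (compactPart G) x = maxClosedOrbitDim G X}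

/-- The moment map component `x ↦ (1 / 2i) ⟨A x, x⟩`, where `⟨·, ·⟩` is linear in its first
argument (in Mathlib's `inner` it is the second one).  For skew-Hermitian `A` the number
`⟨A x, x⟩` is purely imaginary, so that this real part is the value itself. -/
def momentComponent (A : Matrix (Fin n) (Fin n) ℂ) (x : V n) : ℝ :=
  ((1 / (2 * Complex.I)) * inner ℂ x (act A x)).re

/-- The differential at `x` of the moment map component of `A`, restricted to `T_x(X)`. -/
def momentDifferential (X : Set (V n)) (A : Matrix (Fin n) (Fin n) ℂ) (x : V n) :
    (tangentSpace X x).restrictScalars ℝ →ₗ[ℝ] ℝ :=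
  (fderiv ℝ (momentComponent A) x).toLinearMap.domRestrict
    ((tangentSpace X x).restrictScalars ℝ)

end Groups

/-! ### Embedded real submanifolds -/

section Submanifolds

variable {E : Type*} [NormedAddCommGroup E] [NormedSpace ℝ E]

/-- A smooth chart of the real vector space `E`: a `C^∞` diffeomorphism between open sets. -/
def IsSmoothChart (φ : OpenPartialHomeomorph E E) : Prop :=
  ContDiffOn ℝ ∞ φ φ.source ∧ ContDiffOn ℝ ∞ φ.symm φ.target

/-- The chart `φ` straightens the set `Y` to the linear subspace `L`. -/
def Straightens (φ : OpenPartialHomeomorph E E) (Y : Set E) (L : Submodule ℝ E) : Prop :=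
  ∀ z ∈ φ.source, z ∈ Y ↔ φ z ∈ L

/-- `Y` is an embedded smooth real submanifold of `E` of dimension `k`. -/
def IsRealSubmanifold (Y : Set E) (k : ℤ) : Prop :=
  ∀ y ∈ Y, ∃ (φ : OpenPartialHomeomorph E E) (L : Submodule ℝ E),
    y ∈ φ.source ∧ IsSmoothChart φ ∧ Straightens φ Y L ∧ (Module.finrank ℝ L : ℤ) = k

/-- `Y` is an embedded smooth real submanifold of `E` of dimension `l`, and `M ⊆ Y` is an
embedded smooth real submanifold of the manifold `Y`, of dimension `k`: around each point of `M`
a single chart straightens `Y` to a subspace `L` and `M` to a subspace of `L`. -/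
def IsRealSubmanifoldOf (M Y : Set E) (k l : ℤ) : Prop :=
  IsRealSubmanifold Y l ∧ M ⊆ Y ∧
    ∀ x ∈ M, ∃ (φ : OpenPartialHomeomorph E E) (L N : Submodule ℝ E),
      x ∈ φ.source ∧ IsSmoothChart φ ∧
      Straightens φ Y L ∧ (Module.finrank ℝ L : ℤ) = l ∧
      N ≤ L ∧ Straightens φ M N ∧ (Module.finrank ℝ N : ℤ) = k

end Submanifolds

/-- `A₁, …, A_d ∈ Lie(K)`, and `A₁ v, …, A_d v` are linearly independent over `ℝ`. -/
def IsOrbitFrame {n d : ℕ} (K : Subgroup (GL (Fin n) ℂ)) (v : V n)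
    (A : Fin d → Matrix (Fin n) (Fin n) ℂ) : Prop :=
  (∀ j, A j ∈ lieAlg K) ∧ LinearIndependent ℝ (fun j => act (A j) v)

end KempfNess

end

/-!
The proof has an algebraic and a Lie theoretic half; the chart is then elementary.

*Smooth points.* Let `x` be a point of `X` whose Zariski tangent space has dimension `dim X`, and
choose `c = n - dim X` elements `pᵢ` of the ideal `I` of `X` with independent gradients at `x`. They
are part of a regular system of parameters of the local ring of `ℂⁿ` at `x`, hence generate there a
prime ideal of height at least `c` (`isPrime_span_image_of_span_eq_maximalIdeal`,
`card_le_height_span_image`). It is contained in the ideal of `X`, whose height is at most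
`n - trdeg = c` because the transcendence degree drops along a chain of primes
(`MvPolynomial.height_le_of_le_trdeg_quotient_add`). So the two agree, that is, `f I ⊆ (p₁, …, p_c)`
for some `f` with `f x ≠ 0`. Hence near `x` the `pᵢ` cut out `X` and, by differentiation, all its
tangent spaces (`KempfNess.exists_local_equations`).

*Moment map.* For a Zariski closed group, `Lie(G)` consists of the matrices whose left invariant
vector fields preserve the ideal of `G`, which makes it a complex Lie algebra
(`KempfNess.mem_lieAlg_iff`). For `v ∈ Crit(X)`, the vanishing of `⟨[A, B] v, v⟩` makes `Lie(K) v`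
and `i Lie(K) v` orthogonal for the real inner product, so a real frame `A₁ v, …, A_d v` of the
tangent space of `K v` is independent over `ℂ`, and so is `A₁ u, …, A_d u` for `u` near `v`. Since
no orbit in `X` has complex dimension above `d`, these vectors span `Lie(G) u` over `ℂ`. Therefore
`⟨Aⱼ u, u⟩ = 0` for all `j` already gives `u ∈ Crit(X)`, and then `dim K u = d`
(`KempfNess.mem_critO_of_momentComponent_eq_zero`). The differentials are independent on `T_u(X)`
because `dg_A` takes the value `-|A u|²` on the tangent vector `i A u`
(`KempfNess.linearIndependent_momentDifferential`).

Thus the `pᵢ` and the `g_{Aⱼ}` together form a submersion at `v`, and a chart that makes this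
submersion linear straightens `X_reg` and the set of critical points simultaneously
(`KempfNess.exists_isSmoothChart_straightens`).
-/

/-! ### Regular systems of parameters -/

open IsLocalRing in
/-- The dimension of a Noetherian local ring is at most the number of generators of its maximal
ideal. -/
theorem ringKrullDim_le_card_of_span_eq_maximalIdeal {T ι : Type*} [CommRing T] [IsLocalRing T]
    [IsNoetherianRing T] [Fintype ι] (x : ι → T)
    (hx : Ideal.span (Set.range x) = maximalIdeal T) :
    ringKrullDim T ≤ (Fintype.card ι : ℕ) := by
  refine (ringKrullDim_le_spanFinrank_maximalIdeal T).trans ?_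
  rw [← hx]
  have h1 := Submodule.spanFinrank_span_le_ncard_of_finite (R := T) (Set.finite_range x)
  have h2 : (Set.range x).ncard ≤ Fintype.card ι := by
    rw [← Set.image_univ]
    refine (Set.ncard_image_le Set.finite_univ).trans ?_
    rw [Set.ncard_univ, Nat.card_eq_fintype_card]
  exact_mod_cast h1.trans h2

open IsLocalRing in
theorem span_range_quotient_mk_eq_maximalIdeal {T ι : Type*} [CommRing T] [IsLocalRing T]
    (I : Ideal T) [IsLocalRing (T ⧸ I)] (x : ι → T)
    (hx : Ideal.span (Set.range x) = maximalIdeal T) :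
    Ideal.span (Set.range (Ideal.Quotient.mk I ∘ x)) = maximalIdeal (T ⧸ I) := by
  rw [Set.range_comp, ← Ideal.map_span, hx]
  exact map_maximalIdeal_of_surjective _ Ideal.Quotient.mk_surjective

theorem exists_isPrime_ringKrullDim_quotient_ge {T : Type*} [CommRing T] {N : ℕ}
    (h : (N : WithBot ℕ∞) ≤ ringKrullDim T) :
    ∃ q : Ideal T, q.IsPrime ∧ (N : WithBot ℕ∞) ≤ ringKrullDim (T ⧸ q) := by
  obtain ⟨l, hl⟩ := Order.le_krullDim_iff.1 h
  refine ⟨l.head.asIdeal, l.head.2, ?_⟩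
  rw [ringKrullDim_quotient]
  refine Order.le_krullDim_iff.2 ⟨⟨l.length, fun i => ⟨l i, ?_⟩, fun i => ?_⟩, hl⟩
  · exact l.head_le i
  · exact l.step i

open IsLocalRing in
theorem span_range_tail_eq_maximalIdeal {T : Type*} [CommRing T] [IsLocalRing T] {N : ℕ}
    (x : Fin (N + 1) → T) (hx : Ideal.span (Set.range x) = maximalIdeal T) :
    ∃ _ : IsLocalRing (T ⧸ Ideal.span {x 0}),
      Ideal.span (Set.range fun i => Ideal.Quotient.mk (Ideal.span {x 0}) (x (Fin.succ i))) =
        maximalIdeal (T ⧸ Ideal.span {x 0}) := by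
  have hmem : x 0 ∈ maximalIdeal T := hx ▸ Ideal.subset_span ⟨0, rfl⟩
  have hne : Ideal.span {x 0} ≠ ⊤ := by
    intro h
    exact (mem_maximalIdeal _).1 hmem (Ideal.span_singleton_eq_top.1 h)
  have : Nontrivial (T ⧸ Ideal.span {x 0}) := Ideal.Quotient.nontrivial_iff.2 hne
  have hloc : IsLocalRing (T ⧸ Ideal.span {x 0}) :=
    IsLocalRing.of_surjective' _ Ideal.Quotient.mk_surjective
  refine ⟨hloc, ?_⟩
  rw [← span_range_quotient_mk_eq_maximalIdeal _ x hx]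
  refine le_antisymm (Ideal.span_mono ?_) (Ideal.span_le.2 ?_)
  · rintro _ ⟨i, rfl⟩
    exact ⟨i.succ, rfl⟩
  · rintro _ ⟨i, rfl⟩
    refine Fin.cases ?_ (fun j => ?_) i
    · have : Ideal.Quotient.mk (Ideal.span {x 0}) (x 0) = 0 :=
        Ideal.Quotient.eq_zero_iff_mem.2 (Ideal.mem_span_singleton_self _)
      simp only [Function.comp_apply, this]
      exact Ideal.zero_mem _
    · exact Ideal.subset_span ⟨j, rfl⟩

theorem WithBot.natCast_le_of_add_le_add {a : WithBot ℕ∞} {N k : ℕ}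
    (h : ((N + k : ℕ) : WithBot ℕ∞) ≤ a + (k : ℕ)) : (N : WithBot ℕ∞) ≤ a := by
  rw [Nat.cast_add] at h
  exact ENat.WithBot.add_le_add_natCast_right_iff.1 h

open IsLocalRing in
/-- Killing finitely many elements of the maximal ideal lowers the dimension by at most their
number. -/
theorem natCast_le_ringKrullDim_quotient {T : Type*} [CommRing T] [IsLocalRing T]
    [IsNoetherianRing T] (s : Finset T) (hs : (s : Set T) ⊆ maximalIdeal T) {N k : ℕ}
    (hk : s.card ≤ k) (hdim : ((N + k : ℕ) : WithBot ℕ∞) ≤ ringKrullDim T) :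
    (N : WithBot ℕ∞) ≤ ringKrullDim (T ⧸ Ideal.span (s : Set T)) := by
  have h := ringKrullDim_le_ringKrullDim_quotient_add_card s
    (by rwa [IsLocalRing.ringJacobson_eq_maximalIdeal])
  refine WithBot.natCast_le_of_add_le_add (hdim.trans (h.trans ?_))
  gcongr

open IsLocalRing in
/-- A Noetherian local ring of dimension at least `N` whose maximal ideal is generated by `N`
elements (that is, a regular local ring) is a domain.  Modulo the first generator `a` the ring is a
domain by induction.  A prime `q` with `dim T / q = dim T` lies in `(a)`, as otherwise `T / (a)`
would have too large a dimension; as `a ∉ q`, this gives `q = a q`, so `q = 0`. -/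
theorem isDomain_of_span_eq_maximalIdeal (N : ℕ) : ∀ (T : Type*) [CommRing T] [IsLocalRing T]
    [IsNoetherianRing T] (x : Fin N → T), Ideal.span (Set.range x) = maximalIdeal T →
    (N : WithBot ℕ∞) ≤ ringKrullDim T → IsDomain T := by
  induction N with
  | zero =>
    intro T _ _ _ x hx _
    have : maximalIdeal T = ⊥ := by simpa using hx.symm
    exact (isField_iff_maximalIdeal_eq.2 this).isDomain
  | succ N ih =>
    have dimq : ∀ (T : Type _) [CommRing T] [IsLocalRing T] [IsNoetherianRing T]
        (x : Fin (N + 1) → T), Ideal.span (Set.range x) = maximalIdeal T →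
        ((N + 1 : ℕ) : WithBot ℕ∞) ≤ ringKrullDim T →
        (N : WithBot ℕ∞) ≤ ringKrullDim (T ⧸ Ideal.span {x 0}) := by
      intro T _ _ _ x hx hdim
      have hmem : x 0 ∈ maximalIdeal T := hx ▸ Ideal.subset_span ⟨0, rfl⟩
      have h := natCast_le_ringKrullDim_quotient ({x 0} : Finset T) (by simpa using hmem)
        (k := 1) (by simp) hdim
      rwa [Finset.coe_singleton] at h
    intro T _ _ _ x hx hdim
    obtain ⟨q, hq, hqdim⟩ := exists_isPrime_ringKrullDim_quotient_ge hdim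
    obtain ⟨hloc1, hspan1⟩ := span_range_tail_eq_maximalIdeal x hx
    have hdom : IsDomain (T ⧸ Ideal.span {x 0}) := ih _ _ hspan1 (dimq T x hx hdim)
    have hup := ringKrullDim_le_card_of_span_eq_maximalIdeal _ hspan1
    rw [Fintype.card_fin] at hup
    have : Nontrivial (T ⧸ q) := Ideal.Quotient.nontrivial_iff.2 hq.ne_top
    have hloc2 : IsLocalRing (T ⧸ q) :=
      IsLocalRing.of_surjective' _ Ideal.Quotient.mk_surjective
    have hdim2 := dimq (T ⧸ q) (Ideal.Quotient.mk q ∘ x)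
      (span_range_quotient_mk_eq_maximalIdeal q x hx) hqdim
    have hlt : ¬ ((N : WithBot ℕ∞) + 1 ≤ N) := by
      intro h
      have h' : ((N + 1 : ℕ) : WithBot ℕ∞) ≤ (N : ℕ) := by simpa using h
      exact absurd (by exact_mod_cast h' : N + 1 ≤ N) (by omega)
    have hqle : q ≤ Ideal.span {x 0} := by
      intro r hr
      by_contra hr0
      let J : Ideal (T ⧸ q) := Ideal.span {(Ideal.Quotient.mk q ∘ x) 0}
      let f : (T ⧸ Ideal.span {x 0}) →+* ((T ⧸ q) ⧸ J) :=
        Ideal.Quotient.lift _ ((Ideal.Quotient.mk J).comp (Ideal.Quotient.mk q)) (by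
          intro a ha
          obtain ⟨b, rfl⟩ := Ideal.mem_span_singleton.1 ha
          refine Ideal.Quotient.eq_zero_iff_mem.2 ?_
          rw [map_mul]
          exact Ideal.mul_mem_right _ _ (Ideal.mem_span_singleton_self _))
      have hf : Function.Surjective f := by
        apply Ideal.Quotient.lift_surjective_of_surjective
        exact Ideal.Quotient.mk_surjective.comp Ideal.Quotient.mk_surjective
      have h := ringKrullDim_succ_le_of_surjective f hf
        (r := Ideal.Quotient.mk _ r)
        (mem_nonZeroDivisors_of_ne_zero fun h => hr0 (Ideal.Quotient.eq_zero_iff_mem.1 h))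
        (by
          have hr1 : Ideal.Quotient.mk q r = 0 := Ideal.Quotient.eq_zero_iff_mem.2 hr
          simp [f, hr1])
      exact hlt ((add_le_add_left hdim2 1).trans (h.trans hup))
    have hx0 : x 0 ∉ q := by
      intro hmem
      have : q = Ideal.span {x 0} :=
        le_antisymm hqle ((Ideal.span_singleton_le_iff_mem _).2 hmem)
      rw [this] at hqdim
      refine hlt (le_trans ?_ (hqdim.trans hup))
      push_cast
      exact le_rfl
    have hbot : q = ⊥ := by
      refine Submodule.eq_bot_of_le_smul_of_le_jacobson_bot (Ideal.span {x 0}) q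
        (IsNoetherian.noetherian q) ?_ ?_
      · intro y hy
        obtain ⟨z, rfl⟩ := Ideal.mem_span_singleton.1 (hqle hy)
        have hz : z ∈ q := (hq.mem_or_mem hy).resolve_left hx0
        exact Submodule.smul_mem_smul (Ideal.mem_span_singleton_self _) hz
      · rw [IsLocalRing.jacobson_eq_maximalIdeal _ bot_ne_top, ← hx]
        exact Ideal.span_mono (by rintro _ rfl; exact ⟨0, rfl⟩)
    subst hbot
    exact IsDomain.of_bot_isPrime T

open IsLocalRing in
/-- Any subset of a regular system of parameters generates a prime ideal. -/
theorem isPrime_span_image_of_span_eq_maximalIdeal {T ι : Type*} [CommRing T] [IsLocalRing T]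
    [IsNoetherianRing T] [Fintype ι] (x : ι → T) (hx : Ideal.span (Set.range x) = maximalIdeal T)
    (hdim : (Fintype.card ι : WithBot ℕ∞) ≤ ringKrullDim T) (s : Finset ι) :
    (Ideal.span (x '' s)).IsPrime := by
  classical
  have hle : x '' s ⊆ maximalIdeal T := by
    rw [← hx]
    exact (Set.image_subset_range _ _).trans Ideal.subset_span
  have hne : Ideal.span (x '' s) ≠ ⊤ := fun h =>
    (maximalIdeal.isMaximal T).ne_top (top_le_iff.1 (h ▸ Ideal.span_le.2 hle))
  have : Nontrivial (T ⧸ Ideal.span (x '' s)) := Ideal.Quotient.nontrivial_iff.2 hne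
  have hloc : IsLocalRing (T ⧸ Ideal.span (x '' s)) :=
    IsLocalRing.of_surjective' _ Ideal.Quotient.mk_surjective
  have hd : ((sᶜ).card : WithBot ℕ∞) ≤ ringKrullDim (T ⧸ Ideal.span (x '' s)) := by
    have h := natCast_le_ringKrullDim_quotient (s.image x) (by simpa using hle)
      (N := (sᶜ).card) (k := s.card) Finset.card_image_le
      (by rwa [add_comm, Finset.card_add_card_compl])
    rwa [Finset.coe_image] at h
  rw [← Ideal.Quotient.isDomain_iff_prime]
  refine isDomain_of_span_eq_maximalIdeal (sᶜ).card _
    (fun i => Ideal.Quotient.mk _ (x ((sᶜ).equivFin.symm i))) ?_ hd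
  rw [← span_range_quotient_mk_eq_maximalIdeal _ x hx]
  refine le_antisymm (Ideal.span_mono ?_) (Ideal.span_le.2 ?_)
  · rintro _ ⟨i, rfl⟩
    exact ⟨_, rfl⟩
  · rintro _ ⟨i, rfl⟩
    by_cases hi : i ∈ s
    · have : Ideal.Quotient.mk (Ideal.span (x '' s)) (x i) = 0 :=
        Ideal.Quotient.eq_zero_iff_mem.2 (Ideal.subset_span ⟨i, hi, rfl⟩)
      simp only [Function.comp_apply, this]
      exact Ideal.zero_mem _
    · refine Ideal.subset_span ⟨(sᶜ).equivFin ⟨i, by simpa using hi⟩, ?_⟩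
      simp

open IsLocalRing in
/-- Adding the members of a subset of a regular system of parameters one by one gives a strictly
increasing chain of prime ideals. -/
theorem card_le_height_span_image {T ι : Type*} [CommRing T] [IsLocalRing T]
    [IsNoetherianRing T] [Fintype ι] (x : ι → T) (hx : Ideal.span (Set.range x) = maximalIdeal T)
    (hdim : (Fintype.card ι : WithBot ℕ∞) ≤ ringKrullDim T) (s : Finset ι) :
    (s.card : ℕ∞) ≤ (Ideal.span (x '' s)).height := by
  classical
  induction s using Finset.induction_on with
  | empty => simp
  | insert a s ha ih =>
    have h1 := isPrime_span_image_of_span_eq_maximalIdeal x hx hdim s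
    have h2 := isPrime_span_image_of_span_eq_maximalIdeal x hx hdim (insert a s)
    rw [Finset.card_insert_of_notMem ha, Nat.cast_add, Nat.cast_one]
    have hle : Ideal.span (x '' s) ≤ Ideal.span (x '' (insert a s : Finset ι)) :=
      Ideal.span_mono (Set.image_mono (by simp))
    refine (add_le_add_left ih 1).trans (Ideal.height_add_one_le_of_lt_of_isPrime
      (lt_of_le_of_ne hle fun heq => ?_))
    have hmem : x a ∈ Ideal.span (x '' s) := by
      rw [heq]
      exact Ideal.subset_span ⟨a, by simp, rfl⟩
    -- Then `x a` is redundant, so that the dimension is at most `card ι - 1`.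
    have hspan : Ideal.span (Set.range fun i : {i // i ≠ a} => x i) = maximalIdeal T := by
      rw [← hx]
      refine le_antisymm (Ideal.span_mono ?_) (Ideal.span_le.2 ?_)
      · rintro _ ⟨i, rfl⟩
        exact ⟨_, rfl⟩
      · rintro _ ⟨i, rfl⟩
        by_cases hi : i = a
        · subst hi
          refine Ideal.span_mono ?_ hmem
          rintro _ ⟨j, hj, rfl⟩
          exact ⟨⟨j, fun h => ha (h ▸ hj)⟩, rfl⟩
        · exact Ideal.subset_span ⟨⟨i, hi⟩, rfl⟩
    have h3 := hdim.trans (ringKrullDim_le_card_of_span_eq_maximalIdeal _ hspan)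
    have h4 : Fintype.card ι ≤ Fintype.card {i // i ≠ a} := by exact_mod_cast h3
    exact absurd h4 (not_le.2 (Fintype.card_subtype_lt (x := a) (by simp)))

/-! ### Height and transcendence degree -/

/-- A non-trivial quotient domain has strictly smaller transcendence degree. -/
theorem trdeg_quotient_add_one_le {k A : Type*} [Field k] [CommRing A] [IsDomain A] [Algebra k A]
    (q : Ideal A) [q.IsPrime] (hq : q ≠ ⊥) :
    Algebra.trdeg k (A ⧸ q) + 1 ≤ Algebra.trdeg k A := by
  obtain ⟨b, hbq, hb0⟩ := Submodule.exists_mem_ne_zero_of_ne_bot hq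
  have : FaithfulSMul k (A ⧸ q) :=
    (faithfulSMul_iff_algebraMap_injective k (A ⧸ q)).2 (algebraMap k (A ⧸ q)).injective
  obtain ⟨s, hs⟩ := exists_isTranscendenceBasis k (A ⧸ q)
  let y : s → A := fun i => (Ideal.Quotient.mk_surjective i.1).choose
  have hy : ∀ i, Ideal.Quotient.mkₐ k q (y i) = i.1 :=
    fun i => (Ideal.Quotient.mk_surjective i.1).choose_spec
  have hyq : AlgebraicIndependent k (Ideal.Quotient.mkₐ k q ∘ y) := by
    have : (Ideal.Quotient.mkₐ k q ∘ y) = ((↑) : s → A ⧸ q) := funext hy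
    rw [this]
    exact hs.1
  have hyA : AlgebraicIndependent k y := hyq.of_comp
  have htr : Transcendental (Algebra.adjoin k (Set.range y)) b := by
    intro halg
    obtain ⟨r, hr0, hdvd⟩ := halg.exists_nonzero_dvd (mem_nonZeroDivisors_of_ne_zero hb0)
    have hrq : (r : A) ∈ q := q.mem_of_dvd hdvd hbq
    obtain ⟨f, hf⟩ := (Algebra.adjoin_range_eq_range_aeval k y).le r.2
    have hf' : MvPolynomial.aeval y f = (r : A) := hf
    have h0 : MvPolynomial.aeval (Ideal.Quotient.mkₐ k q ∘ y) f = 0 := by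
      have e : MvPolynomial.aeval (Ideal.Quotient.mkₐ k q ∘ y) f
          = Ideal.Quotient.mkₐ k q (MvPolynomial.aeval y f) := by
        rw [← AlgHom.comp_apply, MvPolynomial.comp_aeval]
        rfl
      rw [e, hf']
      exact Ideal.Quotient.eq_zero_iff_mem.2 hrq
    have hf0 : f = 0 := (algebraicIndependent_iff_injective_aeval.1 hyq)
      (by rw [h0, map_zero])
    apply hr0
    ext
    rw [← hf', hf0, map_zero]
    rfl
  have h := ((hyA.option_iff_transcendental b).2 htr).lift_cardinalMk_le_trdeg
  rw [← hs.cardinalMk_eq_trdeg]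
  simpa using h

theorem trdeg_quotient_add_one_le_of_lt {k R : Type*} [Field k] [CommRing R] [Algebra k R]
    {p q : Ideal R} [p.IsPrime] [q.IsPrime] (h : p < q) :
    Algebra.trdeg k (R ⧸ q) + 1 ≤ Algebra.trdeg k (R ⧸ p) := by
  have hq' : (q.map (Ideal.Quotient.mkₐ k p)).IsPrime :=
    Ideal.map_isPrime_of_surjective (Ideal.Quotient.mkₐ_surjective k p)
      ((Ideal.Quotient.mkₐ_ker k p).trans_le h.le)
  have e := (DoubleQuot.quotQuotEquivQuotOfLEₐ k h.le).trdeg_eq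
  rw [← e]
  refine trdeg_quotient_add_one_le _ ?_
  intro hbot
  rw [Ideal.map_eq_bot_iff_le_ker] at hbot
  exact absurd (hbot.trans_eq (Ideal.Quotient.mkₐ_ker k p)) h.not_ge

/-- `height p + trdeg (k[X] / p) ≤ n` for a prime ideal `p` of a polynomial ring in `n`
variables. -/
theorem MvPolynomial.height_le_of_le_trdeg_quotient_add {k : Type*} [Field k] {n : ℕ} (c : ℕ) :
    ∀ p : Ideal (MvPolynomial (Fin n) k), p.IsPrime →
      (n : Cardinal) ≤ Algebra.trdeg k (MvPolynomial (Fin n) k ⧸ p) + (c : ℕ) → p.height ≤ c := by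
  induction c with
  | zero =>
    intro p hp h
    rw [Ideal.height_le_iff]
    intro q hq hqp
    exfalso
    have h1 := trdeg_quotient_add_one_le_of_lt (k := k) hqp
    have h2 : Algebra.trdeg k (MvPolynomial (Fin n) k ⧸ q) ≤ n := by
      refine (trdeg_le_of_surjective (Ideal.Quotient.mkₐ k q)
        (Ideal.Quotient.mkₐ_surjective k q)).trans ?_
      rw [MvPolynomial.trdeg_of_isDomain]
      simp
    have h3 : (n : Cardinal) + 1 ≤ n := by
      refine le_trans ?_ (h1.trans h2)
      simpa using h
    exact absurd (by exact_mod_cast h3 : n + 1 ≤ n) (by omega)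
  | succ c ih =>
    intro p hp h
    rw [Ideal.height_le_iff]
    intro q hq hqp
    have h1 := trdeg_quotient_add_one_le_of_lt (k := k) hqp
    refine lt_of_le_of_lt (ih q hq (h.trans ?_)) (by exact_mod_cast Nat.lt_succ_self c)
    calc _ = (Algebra.trdeg k (MvPolynomial (Fin n) k ⧸ p) + 1) + (c : ℕ) := by
          push_cast; ring
      _ ≤ _ := by gcongr

/-- The maximal ideal of a point of `kⁿ` has height at least `n`: the ideals generated by the first
few `Xᵢ - aᵢ` form a chain. -/
theorem MvPolynomial.le_height_vanishingIdeal_singleton {k : Type*} [Field k] {n : ℕ}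
    (a : Fin n → k) : (n : ℕ∞) ≤ (vanishingIdeal k {a}).height := by
  let φ : ℕ → (MvPolynomial (Fin n) k →ₐ[k] MvPolynomial (Fin n) k) := fun j =>
    aeval fun i => if (i : ℕ) < j then C (a i) else X i
  have hprime : ∀ j, (RingHom.ker (φ j)).IsPrime := fun j => RingHom.ker_isPrime _
  have hφ : ∀ j, (φ (j + 1)) = (φ (j + 1)).comp (φ j) := by
    intro j
    apply algHom_ext
    intro i
    simp only [φ, AlgHom.comp_apply, aeval_X]
    by_cases hij : (i : ℕ) < j
    · simp [hij, Nat.lt_succ_of_lt hij, algHom_C]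
    · simp [hij]
  have key : ∀ j ≤ n, (j : ℕ∞) ≤ (RingHom.ker (φ j)).height := by
    intro j
    induction j with
    | zero => simp
    | succ j ih =>
      intro hj
      have hlt : RingHom.ker (φ j) < RingHom.ker (φ (j + 1)) := by
        refine SetLike.lt_iff_le_and_exists.2 ⟨fun p hp => ?_, X ⟨j, hj⟩ - C (a ⟨j, hj⟩), ?_, ?_⟩
        · rw [RingHom.mem_ker] at hp ⊢
          rw [hφ, AlgHom.comp_apply, hp, map_zero]
        · simp [RingHom.mem_ker, φ, algHom_C]
        · simp only [RingHom.mem_ker, φ, map_sub, aeval_X, lt_irrefl, if_false]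
          intro h
          have h' := congrArg (coeff (Finsupp.single (⟨j, hj⟩ : Fin n) 1)) h
          have e : (aeval fun i : Fin n => if (i : ℕ) < j then C (a i) else X i)
            (C (a ⟨j, hj⟩) : MvPolynomial (Fin n) k) = C (a ⟨j, hj⟩) := by
            rw [algHom_C, algebraMap_eq]
          rw [e] at h'
          simp [coeff_C, Finsupp.single_eq_zero, eq_comm] at h'
      have := Ideal.height_add_one_le_of_lt_of_isPrime hlt
      push_cast
      exact (add_le_add_left (ih (by omega)) 1).trans this
  refine (key n le_rfl).trans (Ideal.height_mono fun p hp => ?_)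
  rw [mem_vanishingIdeal_singleton_iff]
  rw [RingHom.mem_ker] at hp
  have e : (aeval a : MvPolynomial (Fin n) k →ₐ[k] k) = (aeval a).comp (φ n) := by
    apply algHom_ext
    intro i
    simp [φ]
  rw [e, AlgHom.comp_apply, hp, map_zero]

/-! ### Local equations at a smooth point -/

namespace MvPolynomial

variable {k : Type*} [Field k] {n : ℕ}

/-- The gradient of a polynomial at the point `a`, as a linear function of the polynomial. -/
noncomputable def gradAt (a : Fin n → k) : MvPolynomial (Fin n) k →ₗ[k] (Fin n → k) where
  toFun p := fun i => eval a (pderiv i p)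
  map_add' p q := by ext i; simp
  map_smul' c p := by ext i; simp

theorem gradAt_apply (a : Fin n → k) (p : MvPolynomial (Fin n) k) (i : Fin n) :
    gradAt a p i = eval a (pderiv i p) := rfl

theorem gradAt_mul (a : Fin n → k) (p q : MvPolynomial (Fin n) k) :
    gradAt a (p * q) = eval a p • gradAt a q + eval a q • gradAt a p := by
  ext i
  simp [gradAt_apply, Derivation.leibniz]

/-- A linear polynomial that vanishes at `a` and has prescribed gradient. -/
theorem exists_eval_eq_zero_gradAt_eq (a w : Fin n → k) :
    ∃ p : MvPolynomial (Fin n) k, eval a p = 0 ∧ gradAt a p = w := by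
  refine ⟨∑ i, C (w i) * (X i - C (a i)), by simp, ?_⟩
  ext j
  simp only [gradAt_apply, map_sum, Derivation.leibniz, map_sub, pderiv_C, smul_eq_mul, mul_zero,
    sub_zero, add_zero, map_mul, eval_C, pderiv_X]
  rw [Finset.sum_eq_single j]
  · simp
  · intro i _ hij
    simp [hij]
  · simp

theorem mem_vanishingIdeal_singleton_iff_eval {a : Fin n → k} {p : MvPolynomial (Fin n) k} :
    p ∈ vanishingIdeal k {a} ↔ eval a p = 0 := by
  rw [mem_vanishingIdeal_singleton_iff, aeval_eq_eval]

/-- First order Taylor expansion at `a`, with remainder in the square of the maximal ideal. -/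
theorem sub_taylor_mem_vanishingIdeal_sq (a : Fin n → k) (p : MvPolynomial (Fin n) k) :
    p - C (eval a p) - ∑ i, C (gradAt a p i) * (X i - C (a i)) ∈
      vanishingIdeal k {a} ^ 2 := by
  have hX : ∀ i, (X i - C (a i) : MvPolynomial (Fin n) k) ∈ vanishingIdeal k {a} := fun i => by
    rw [mem_vanishingIdeal_singleton_iff_eval]
    simp
  induction p using MvPolynomial.induction_on with
  | C c => simp [gradAt_apply]
  | add p q hp hq =>
    convert! add_mem hp hq using 1
    simp only [map_add, Pi.add_apply, add_mul, Finset.sum_add_distrib]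
    ring
  | mul_X p j hp =>
    have hs : ∑ i, C (gradAt a p i) * (X i - C (a i)) ∈ vanishingIdeal k {a} :=
      sum_mem fun i _ => Ideal.mul_mem_left _ _ (hX i)
    have h2 := Ideal.mul_mem_mul hs (hX j)
    rw [← pow_two] at h2
    convert! add_mem (Ideal.mul_mem_right (X j) _ hp) h2 using 1
    have e : ∑ i, C (gradAt a (p * X j) i) * (X i - C (a i)) =
        C (eval a p) * (X j - C (a j)) + C (a j) * ∑ i, C (gradAt a p i) * (X i - C (a i)) := by
      rw [gradAt_mul, Finset.mul_sum]
      simp only [Pi.add_apply, Pi.smul_apply, smul_eq_mul, eval_X, map_add, map_mul, add_mul,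
        Finset.sum_add_distrib]
      congr 1
      · rw [Finset.sum_eq_single j]
        · simp [gradAt_apply]
        · intro i _ hij
          simp [gradAt_apply, pderiv_X, hij.symm]
        · simp
      · refine Finset.sum_congr rfl fun i _ => by ring
    rw [e]
    simp only [map_mul, eval_X]
    ring

theorem mem_vanishingIdeal_sq_of_gradAt_eq_zero {a : Fin n → k} {p : MvPolynomial (Fin n) k}
    (hp : eval a p = 0) (hg : gradAt a p = 0) : p ∈ vanishingIdeal k {a} ^ 2 := by
  have h := sub_taylor_mem_vanishingIdeal_sq a p
  simpa [hp, hg] using h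

open IsLocalRing in
/-- Polynomials vanishing at `a` whose gradients span `kⁿ` generate the maximal ideal of the local
ring at `a`, by Nakayama's lemma. -/
theorem span_algebraMap_eq_maximalIdeal {ι : Type*} [Fintype ι] (a : Fin n → k)
    (x : ι → MvPolynomial (Fin n) k) (hx : ∀ i, eval a (x i) = 0)
    (hspan : Submodule.span k (Set.range fun i => gradAt a (x i)) = ⊤) :
    Ideal.span (Set.range fun i => algebraMap _ (Localization.AtPrime (vanishingIdeal k {a})) (x i))
      = maximalIdeal (Localization.AtPrime (vanishingIdeal k {a})) := by
  have hle : Ideal.span (Set.range x) ≤ vanishingIdeal k {a} := by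
    rw [Ideal.span_le]
    rintro _ ⟨i, rfl⟩
    exact mem_vanishingIdeal_singleton_iff_eval.2 (hx i)
  have key : vanishingIdeal k {a} ≤ Ideal.span (Set.range x) ⊔ vanishingIdeal k {a} ^ 2 := by
    intro q hq
    have hmem : gradAt a q ∈ Submodule.span k (Set.range fun i => gradAt a (x i)) := by
      rw [hspan]
      trivial
    obtain ⟨c, hc⟩ := (Submodule.mem_span_range_iff_exists_fun k).1 hmem
    have h1 : ∑ i, c i • x i ∈ Ideal.span (Set.range x) :=
      sum_mem fun i _ => Submodule.smul_of_tower_mem _ _ (Ideal.subset_span ⟨i, rfl⟩)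
    have h2 : q - ∑ i, c i • x i ∈ vanishingIdeal k {a} ^ 2 := by
      apply mem_vanishingIdeal_sq_of_gradAt_eq_zero
      · simp [mem_vanishingIdeal_singleton_iff_eval.1 hq, hx]
      · simp [← hc]
    have := Submodule.add_mem_sup h1 h2
    rwa [add_sub_cancel] at this
  have hmap := Localization.AtPrime.map_eq_maximalIdeal (I := vanishingIdeal k {a})
  have e : (Set.range fun i => algebraMap _ (Localization.AtPrime (vanishingIdeal k {a})) (x i))
      = algebraMap _ (Localization.AtPrime (vanishingIdeal k {a})) '' Set.range x := by
    rw [← Set.range_comp]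
    rfl
  rw [e, ← Ideal.map_span]
  refine le_antisymm ((Ideal.map_mono hle).trans_eq hmap) ?_
  have h := Ideal.map_mono (f := algebraMap _ (Localization.AtPrime (vanishingIdeal k {a}))) key
  rw [Ideal.map_sup, Ideal.map_pow, hmap, pow_two] at h
  exact Submodule.le_of_le_smul_of_le_jacobson_bot (IsNoetherian.noetherian _)
    (IsLocalRing.jacobson_eq_maximalIdeal _ bot_ne_top).ge h

/-- Polynomials vanishing at `a` with independent gradients there are part of a regular system of
parameters of `kⁿ` at `a`. -/
theorem exists_extension_of_linearIndependent_gradAt {c : ℕ} (a : Fin n → k)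
    (p : Fin c → MvPolynomial (Fin n) k) (hp : ∀ i, eval a (p i) = 0)
    (hli : LinearIndependent k fun i => gradAt a (p i)) :
    ∃ (m : ℕ) (x : Fin c ⊕ Fin m → MvPolynomial (Fin n) k), c + m = n ∧
      (∀ i, x (Sum.inl i) = p i) ∧ (∀ i, eval a (x i) = 0) ∧
      Submodule.span k (Set.range fun i => gradAt a (x i)) = ⊤ := by
  obtain ⟨W, hW⟩ := Submodule.exists_isCompl
    (Submodule.span k (Set.range fun i => gradAt a (p i)))
  let b := Module.finBasis k W
  choose q hq0 hq using fun j => exists_eval_eq_zero_gradAt_eq a (b j : Fin n → k)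
  refine ⟨Module.finrank k W, Sum.elim p q, ?_, fun i => rfl, ?_, ?_⟩
  · have h := Submodule.finrank_add_eq_of_isCompl hW
    rwa [finrank_span_eq_card hli, Fintype.card_fin, Module.finrank_fin_fun] at h
  · rintro (i | j)
    · exact hp i
    · exact hq0 j
  · have e : (Set.range fun i => gradAt a (Sum.elim p q i)) =
        (Set.range fun i => gradAt a (p i)) ∪ Set.range fun j => (b j : Fin n → k) := by
      rw [← Set.Sum.elim_range]
      congr 1
      ext (i | j) : 1
      · rfl
      · exact hq j
    rw [e, Submodule.span_union]
    have e2 : Submodule.span k (Set.range fun j => (b j : Fin n → k)) = W := by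
      have := congrArg (Submodule.map W.subtype) b.span_eq
      rw [Submodule.map_span, ← Set.range_comp] at this
      simpa [Function.comp_def] using this
    rw [e2]
    exact hW.sup_eq_top

/-- Let `I` be a prime ideal of codimension `c`, contained in the maximal ideal of the point `a`.
If `c` elements of `I` have linearly independent gradients at `a`, then they generate `I` locally
at `a`: they are part of a regular system of parameters, hence generate a prime ideal of
height `c` in the local ring, and the height of `I` is not larger. -/
theorem exists_mul_mem_span_of_linearIndependent_gradAt {c : ℕ} (a : Fin n → k)
    (I : Ideal (MvPolynomial (Fin n) k)) [I.IsPrime] (hI : ∀ q ∈ I, eval a q = 0)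
    (hdim : (n : Cardinal) ≤ Algebra.trdeg k (MvPolynomial (Fin n) k ⧸ I) + (c : ℕ))
    (p : Fin c → MvPolynomial (Fin n) k) (hpI : ∀ i, p i ∈ I)
    (hli : LinearIndependent k fun i => gradAt a (p i)) :
    ∃ f, eval a f ≠ 0 ∧ ∀ q ∈ I, f * q ∈ Ideal.span (Set.range p) := by
  obtain ⟨m, x, hcm, hxp, hx0, hspan⟩ :=
    exists_extension_of_linearIndependent_gradAt a p (fun i => hI _ (hpI i)) hli
  let M : Ideal (MvPolynomial (Fin n) k) := vanishingIdeal k {a}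
  let S := Localization.AtPrime M
  have hmax := span_algebraMap_eq_maximalIdeal a x hx0 hspan
  have hdimS : (Fintype.card (Fin c ⊕ Fin m) : WithBot ℕ∞) ≤ ringKrullDim S := by
    rw [IsLocalization.AtPrime.ringKrullDim_eq_height M S]
    have h := le_height_vanishingIdeal_singleton a
    rw [Fintype.card_sum, Fintype.card_fin, Fintype.card_fin, hcm]
    exact_mod_cast h
  let s : Finset (Fin c ⊕ Fin m) := Finset.univ.image Sum.inl
  have hscard : s.card = c := by
    rw [Finset.card_image_of_injective _ Sum.inl_injective, Finset.card_univ, Fintype.card_fin]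
  let Q : Ideal S := Ideal.span ((fun i => algebraMap _ S (x i)) '' s)
  have hQ : Q.IsPrime := isPrime_span_image_of_span_eq_maximalIdeal _ hmax hdimS s
  have hQh : (s.card : ℕ∞) ≤ Q.height := card_le_height_span_image _ hmax hdimS s
  have hQspan : Q = (Ideal.span (Set.range p)).map (algebraMap _ S) := by
    rw [Ideal.map_span]
    simp only [Q, s, Finset.coe_image, Finset.coe_univ, Set.image_univ, ← Set.range_comp,
      Function.comp_def, hxp]
  have hIM : I ≤ M := fun q hq => mem_vanishingIdeal_singleton_iff_eval.2 (hI q hq)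
  have hQI : Q.under (MvPolynomial (Fin n) k) ≤ I := by
    have hd : Disjoint (M.primeCompl : Set (MvPolynomial (Fin n) k)) (I : Set _) :=
      Set.disjoint_left.2 fun q hq hqI => hq (hIM hqI)
    rw [← IsLocalization.under_map_of_isPrime_disjoint M.primeCompl S ‹I.IsPrime› hd, hQspan]
    refine Ideal.comap_mono (Ideal.map_mono (Ideal.span_le.2 ?_))
    rintro _ ⟨i, rfl⟩
    exact hpI i
  have hIeq : I ≤ Q.under (MvPolynomial (Fin n) k) := by
    by_contra hnot
    have hlt : Q.under (MvPolynomial (Fin n) k) < I := lt_of_le_not_ge hQI hnot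
    have h1 := Ideal.height_add_one_le_of_lt_of_isPrime hlt
    rw [IsLocalization.height_under M.primeCompl Q] at h1
    have h2 := height_le_of_le_trdeg_quotient_add c I ‹_› hdim
    rw [hscard] at hQh
    have h3 : (c : ℕ∞) + 1 ≤ c := (add_le_add_left hQh 1).trans (h1.trans h2)
    exact absurd (by exact_mod_cast h3 : c + 1 ≤ c) (by omega)
  have hex : ∀ q ∈ I, ∃ f, eval a f ≠ 0 ∧ f * q ∈ Ideal.span (Set.range p) := by
    intro q hq
    have h := hIeq hq
    rw [hQspan, Ideal.under_def, Ideal.mem_comap,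
      IsLocalization.algebraMap_mem_map_algebraMap_iff M.primeCompl] at h
    obtain ⟨f, hf, hfq⟩ := h
    exact ⟨f, fun h0 => hf (mem_vanishingIdeal_singleton_iff_eval.2 h0), hfq⟩
  -- The product of the denominators of finitely many generators of `I` works for all of `I`.
  obtain ⟨t, ht⟩ := IsNoetherian.noetherian I
  choose! f hf0 hf using hex
  have htI : ∀ q ∈ t, q ∈ I := fun q hq => ht ▸ Ideal.subset_span hq
  refine ⟨∏ q ∈ t, f q, ?_, fun q hq => ?_⟩
  · rw [map_prod]
    exact Finset.prod_ne_zero_iff.2 fun q hq => hf0 q (htI q hq)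
  · classical
    rw [← ht] at hq
    induction hq using Submodule.span_induction with
    | mem q hq =>
      rw [← Finset.mul_prod_erase t f hq, mul_right_comm]
      exact Ideal.mul_mem_right _ _ (hf q (htI q hq))
    | zero => simp
    | add q r _ _ hq hr => rw [mul_add]; exact add_mem hq hr
    | smul r q _ hq => rw [smul_eq_mul, mul_left_comm]; exact Ideal.mul_mem_left _ _ hq

end MvPolynomial

namespace KempfNess

/-! ### Charts adapted to a submersion -/

section Chart

variable {E : Type*} [NormedAddCommGroup E] [NormedSpace ℝ E]

/-- If the differential `F'` of a smooth map `F` at `x` is onto, with right inverse `s`, then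
`z ↦ z + s (F z - F' z)` is a chart at `x` in which `F` becomes the linear map `F'`. -/
theorem exists_isSmoothChart_of_surjective_fderiv [FiniteDimensional ℝ E] {W : Type*}
    [NormedAddCommGroup W] [NormedSpace ℝ W] [FiniteDimensional ℝ W] {F : E → W}
    (hF : ContDiff ℝ ∞ F) (x : E) (hsurj : Function.Surjective (fderiv ℝ F x))
    {U : Set E} (hU : IsOpen U) (hxU : x ∈ U) :
    ∃ φ : OpenPartialHomeomorph E E, x ∈ φ.source ∧ φ.source ⊆ U ∧ IsSmoothChart φ ∧
      ∀ z, fderiv ℝ F x (φ z) = F z := by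
  have hcomplete : CompleteSpace E := FiniteDimensional.complete ℝ E
  obtain ⟨s, hs⟩ := (fderiv ℝ F x).toLinearMap.exists_rightInverse_of_surjective
    (LinearMap.range_eq_top.2 hsurj)
  let F' := fderiv ℝ F x
  let s' : W →L[ℝ] E := LinearMap.toContinuousLinearMap s
  have hs' : ∀ w, F' (s' w) = w := fun w => LinearMap.congr_fun hs w
  let f : E → E := fun z => z + s' (F z - F' z)
  have hf : ContDiff ℝ ∞ f :=
    contDiff_id.add (s'.contDiff.comp (hF.sub F'.contDiff))
  have hfF : ∀ z, F' (f z) = F z := fun z => by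
    simp only [f, map_add, hs']
    abel
  have hderiv : HasFDerivAt f ((ContinuousLinearEquiv.refl ℝ E : E ≃L[ℝ] E) : E →L[ℝ] E) x := by
    have h1 : HasFDerivAt F F' x := (hF.differentiable (by simp)).differentiableAt.hasFDerivAt
    have h2 := (hasFDerivAt_id x).add (s'.hasFDerivAt.comp x (h1.sub F'.hasFDerivAt))
    convert! h2 using 1
    ext v
    simp
  let ψ := hf.contDiffAt.toOpenPartialHomeomorph f hderiv (n := ∞) (by simp)
  have hψ : ∀ z, ψ z = f z := fun z => rfl
  let D : Set E := {z | fderiv ℝ f z ∈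
    Set.range ((↑) : (E ≃L[ℝ] E) → E →L[ℝ] E)}
  have hD : IsOpen D := ContinuousLinearEquiv.isOpen.preimage (hf.continuous_fderiv (by simp))
  have hxD : x ∈ D := ⟨ContinuousLinearEquiv.refl ℝ E, hderiv.fderiv.symm⟩
  refine ⟨ψ.restrOpen (D ∩ U) (hD.inter hU), ?_, ?_, ⟨?_, ?_⟩, ?_⟩
  · exact ⟨hf.contDiffAt.mem_toOpenPartialHomeomorph_source hderiv (by simp), hxD, hxU⟩
  · exact fun z hz => hz.2.2
  · exact hf.contDiffOn
  · intro y hy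
    have hy' := (ψ.restrOpen (D ∩ U) (hD.inter hU)).map_target hy
    obtain ⟨e, he⟩ := hy'.2.1
    refine ContDiffAt.contDiffWithinAt ?_
    refine OpenPartialHomeomorph.contDiffAt_symm _ hy (f₀' := e) ?_ hf.contDiffAt
    rw [he]
    exact (hf.differentiable (by simp)).differentiableAt.hasFDerivAt
  · exact hfF

theorem finrank_ker_of_surjective [FiniteDimensional ℝ E] {W : Type*} [AddCommGroup W]
    [Module ℝ W] {f : E →ₗ[ℝ] W} (hf : Function.Surjective f) :
    (Module.finrank ℝ (LinearMap.ker f) : ℤ) = Module.finrank ℝ E - Module.finrank ℝ W := by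
  have h := f.finrank_range_add_finrank_ker
  rw [LinearMap.range_eq_top.2 hf, finrank_top] at h
  omega

/-- Near a point where `F = (F₁, F₂)` is a submersion, `{F₁ = 0}` and `{F₁ = F₂ = 0}` are nested
submanifolds. -/
theorem exists_isSmoothChart_straightens [FiniteDimensional ℝ E] {W₁ W₂ : Type*}
    [NormedAddCommGroup W₁] [NormedSpace ℝ W₁] [FiniteDimensional ℝ W₁]
    [NormedAddCommGroup W₂] [NormedSpace ℝ W₂] [FiniteDimensional ℝ W₂]
    {F₁ : E → W₁} {F₂ : E → W₂} (hF₁ : ContDiff ℝ ∞ F₁) (hF₂ : ContDiff ℝ ∞ F₂) {x : E}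
    (hsurj : Function.Surjective fun w => (fderiv ℝ F₁ x w, fderiv ℝ F₂ x w))
    {U Y M : Set E} (hU : IsOpen U) (hxU : x ∈ U) (hY : ∀ z ∈ U, z ∈ Y ↔ F₁ z = 0)
    (hM : ∀ z ∈ U, z ∈ M ↔ F₁ z = 0 ∧ F₂ z = 0) :
    ∃ (φ : OpenPartialHomeomorph E E) (L N : Submodule ℝ E),
      x ∈ φ.source ∧ IsSmoothChart φ ∧
      Straightens φ Y L ∧
      (Module.finrank ℝ L : ℤ) = Module.finrank ℝ E - Module.finrank ℝ W₁ ∧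
      N ≤ L ∧ Straightens φ M N ∧
      (Module.finrank ℝ N : ℤ) =
        Module.finrank ℝ E - (Module.finrank ℝ W₁ + Module.finrank ℝ W₂) := by
  have hd : fderiv ℝ (fun z => (F₁ z, F₂ z)) x = (fderiv ℝ F₁ x).prod (fderiv ℝ F₂ x) :=
    DifferentiableAt.fderiv_prodMk (hF₁.differentiable (by simp)).differentiableAt
      (hF₂.differentiable (by simp)).differentiableAt
  obtain ⟨φ, hx, hφU, hφ, hφF⟩ := exists_isSmoothChart_of_surjective_fderiv (hF₁.prodMk hF₂) x
    (by rw [hd]; exact hsurj) hU hxU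
  rw [hd] at hφF
  have h1 : ∀ z, fderiv ℝ F₁ x (φ z) = F₁ z := fun z => congrArg Prod.fst (hφF z)
  have h2 : ∀ z, fderiv ℝ F₂ x (φ z) = F₂ z := fun z => congrArg Prod.snd (hφF z)
  refine ⟨φ, LinearMap.ker (fderiv ℝ F₁ x).toLinearMap,
    LinearMap.ker ((fderiv ℝ F₁ x).toLinearMap.prod (fderiv ℝ F₂ x).toLinearMap), hx, hφ,
    ?_, ?_, ?_, ?_, ?_⟩
  · intro z hz
    rw [hY z (hφU hz), LinearMap.mem_ker, ← h1]
    rfl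
  · exact finrank_ker_of_surjective (Prod.fst_surjective.comp hsurj)
  · rw [LinearMap.ker_prod]
    exact inf_le_left
  · intro z hz
    rw [hM z (hφU hz), LinearMap.ker_prod, Submodule.mem_inf, LinearMap.mem_ker,
      LinearMap.mem_ker, ← h1, ← h2]
    rfl
  · have h := finrank_ker_of_surjective
      (f := (fderiv ℝ F₁ x).toLinearMap.prod (fderiv ℝ F₂ x).toLinearMap) hsurj
    rw [h, Module.finrank_prod]
    push_cast
    rfl

end Chart
/-! ### The Lie algebra of a Zariski closed group -/

section LieAlgebra

open MvPolynomial

variable {n : ℕ}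

/-- The ideal of the polynomials in the matrix entries that vanish on `G`. -/
def groupIdeal (G : Subgroup (GL (Fin n) ℂ)) : Ideal (MvPolynomial (Fin n × Fin n) ℂ) where
  carrier := {p | ∀ g ∈ G, eval (fun ij => g.val ij.1 ij.2) p = 0}
  zero_mem' := by simp
  add_mem' := by
    intro p q hp hq g hg
    rw [map_add, hp g hg, hq g hg, add_zero]
  smul_mem' := by
    intro p q hq g hg
    rw [smul_eq_mul, map_mul, hq g hg, mul_zero]

/-- The derivation of the polynomials in the matrix entries given by the left invariant vector
field `g ↦ g A`. -/
noncomputable def rightDerivation (A : Matrix (Fin n) (Fin n) ℂ) :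
    Derivation ℂ (MvPolynomial (Fin n × Fin n) ℂ) (MvPolynomial (Fin n × Fin n) ℂ) :=
  mkDerivation ℂ fun ij => ∑ k, C (A k ij.2) * X (ij.1, k)

theorem rightDerivation_X (A : Matrix (Fin n) (Fin n) ℂ) (ij : Fin n × Fin n) :
    rightDerivation A (X ij) = ∑ k, C (A k ij.2) * X (ij.1, k) :=
  mkDerivation_X _ _ _

theorem rightDerivation_add (A B : Matrix (Fin n) (Fin n) ℂ) :
    rightDerivation (A + B) = rightDerivation A + rightDerivation B := by
  apply derivation_ext
  intro ij
  simp [rightDerivation_X, add_mul, Finset.sum_add_distrib]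

theorem rightDerivation_smul (c : ℂ) (A : Matrix (Fin n) (Fin n) ℂ) :
    rightDerivation (c • A) = c • rightDerivation A := by
  apply derivation_ext
  intro ij
  simp [rightDerivation_X, MvPolynomial.smul_eq_C_mul, Finset.mul_sum, mul_assoc]

theorem rightDerivation_rightDerivation_X (A B : Matrix (Fin n) (Fin n) ℂ) (ij : Fin n × Fin n) :
    rightDerivation A (rightDerivation B (X ij)) = rightDerivation (A * B) (X ij) := by
  simp only [rightDerivation_X, map_sum, Derivation.leibniz, smul_eq_mul, Matrix.mul_apply,
    derivation_C, mul_zero, add_zero, Finset.mul_sum, Finset.sum_mul, map_mul]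
  rw [Finset.sum_comm]
  refine Finset.sum_congr rfl fun k _ => Finset.sum_congr rfl fun l _ => ?_
  ring

theorem rightDerivation_commutator (A B : Matrix (Fin n) (Fin n) ℂ) :
    rightDerivation (A * B - B * A) = ⁅rightDerivation A, rightDerivation B⁆ := by
  apply derivation_ext
  intro ij
  rw [Derivation.commutator_apply, rightDerivation_rightDerivation_X,
    rightDerivation_rightDerivation_X]
  simp [rightDerivation_X, sub_mul, Finset.sum_sub_distrib]

attribute [local instance] Matrix.linftyOpNormedRing Matrix.linftyOpNormedAlgebra in
theorem hasDerivAt_mul_exp_apply (g A : Matrix (Fin n) (Fin n) ℂ) (z : ℂ) (i j : Fin n) :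
    HasDerivAt (fun w : ℂ => (g * NormedSpace.exp (w • A)) i j)
      (∑ k, A k j * (g * NormedSpace.exp (z • A)) i k) z := by
  have h := (hasDerivAt_exp_smul_const (𝕂 := ℂ) A z).const_mul g
  let L : Matrix (Fin n) (Fin n) ℂ →L[ℂ] ℂ :=
    LinearMap.toContinuousLinearMap (Matrix.entryLinearMap ℂ ℂ i j)
  have h2 : HasDerivAt (fun w : ℂ => (g * NormedSpace.exp (w • A)) i j)
      ((g * (NormedSpace.exp (z • A) * A)) i j) z := L.hasFDerivAt.comp_hasDerivAt z h
  have e : (g * (NormedSpace.exp (z • A) * A)) i j =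
      ∑ k, A k j * (g * NormedSpace.exp (z • A)) i k := by
    rw [← mul_assoc, Matrix.mul_apply]
    exact Finset.sum_congr rfl fun k _ => mul_comm _ _
  rwa [← e]

/-- Along the curve `w ↦ g exp (w A)` a polynomial is differentiated by `rightDerivation A`. -/
theorem hasDerivAt_eval_mul_exp (g A : Matrix (Fin n) (Fin n) ℂ)
    (p : MvPolynomial (Fin n × Fin n) ℂ) (z : ℂ) :
    HasDerivAt (fun w : ℂ => eval (fun ij => (g * NormedSpace.exp (w • A)) ij.1 ij.2) p)
      (eval (fun ij => (g * NormedSpace.exp (z • A)) ij.1 ij.2) (rightDerivation A p)) z := by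
  induction p using MvPolynomial.induction_on with
  | C c => simpa using hasDerivAt_const z c
  | add p q hp hq =>
    simp only [map_add]
    exact hp.add hq
  | mul_X p ij hp =>
    have h := hp.mul (hasDerivAt_mul_exp_apply g A z ij.1 ij.2)
    simp only [map_mul, eval_X, Derivation.leibniz, map_add, smul_eq_mul, rightDerivation_X,
      map_sum, eval_C]
    convert! h using 1
    ring

theorem iteratedDeriv_eval_exp (A : Matrix (Fin n) (Fin n) ℂ) (k : ℕ)
    (p : MvPolynomial (Fin n × Fin n) ℂ) (z : ℂ) :
    iteratedDeriv k
      (fun w : ℂ => eval (fun ij => (NormedSpace.exp (w • A) : Matrix _ _ ℂ) ij.1 ij.2) p) z =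
      eval (fun ij => (NormedSpace.exp (z • A) : Matrix _ _ ℂ) ij.1 ij.2)
        ((rightDerivation A)^[k] p) := by
  induction k generalizing p with
  | zero => simp
  | succ k ih =>
    rw [iteratedDeriv_succ', Function.iterate_succ_apply, ← ih]
    congr 1
    ext w
    have h := (hasDerivAt_eval_mul_exp 1 A p w).deriv
    simpa only [one_mul] using h

theorem eval_exp_eq_zero {A : Matrix (Fin n) (Fin n) ℂ} {I : Ideal (MvPolynomial (Fin n × Fin n) ℂ)}
    (hI : ∀ p ∈ I, eval (fun ij => (1 : Matrix (Fin n) (Fin n) ℂ) ij.1 ij.2) p = 0)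
    (hA : ∀ p ∈ I, rightDerivation A p ∈ I) {p : MvPolynomial (Fin n × Fin n) ℂ} (hp : p ∈ I)
    (z : ℂ) :
    eval (fun ij => (NormedSpace.exp (z • A) : Matrix _ _ ℂ) ij.1 ij.2) p = 0 := by
  have hdiff : Differentiable ℂ (fun w : ℂ =>
      eval (fun ij => (NormedSpace.exp (w • A) : Matrix _ _ ℂ) ij.1 ij.2) p) := by
    intro w
    have h := (hasDerivAt_eval_mul_exp 1 A p w).differentiableAt
    simpa only [one_mul] using h
  have hiter : ∀ k, (rightDerivation A)^[k] p ∈ I := by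
    intro k
    induction k with
    | zero => exact hp
    | succ k ih =>
      rw [Function.iterate_succ_apply']
      exact hA _ ih
  have h := Complex.taylorSeries_eq_of_entire' 0 z hdiff
  simp only [iteratedDeriv_eval_exp, zero_smul, NormedSpace.exp_zero,
    hI _ (hiter _), mul_zero, zero_mul, tsum_zero] at h
  exact h.symm

/-- The Lie algebra of a Zariski closed group consists of the matrices whose left invariant vector
fields preserve the ideal of the group: one inclusion by differentiation, the other one because the
Taylor coefficients of `z ↦ p (exp (z A))` at `0` vanish for all `p` in that ideal. -/
theorem mem_lieAlg_iff {G : Subgroup (GL (Fin n) ℂ)} (hG : IsZariskiClosedSubgroup G)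
    {A : Matrix (Fin n) (Fin n) ℂ} :
    A ∈ lieAlg G ↔ ∀ p ∈ groupIdeal G, rightDerivation A p ∈ groupIdeal G := by
  constructor
  · intro hA p hp g hg
    have h0 : ∀ t : ℝ,
        eval (fun ij => (g.val * NormedSpace.exp ((t : ℂ) • A)) ij.1 ij.2) p = 0 := by
      intro t
      obtain ⟨h, hh, hexp⟩ := hA t
      have := hp (g * h) (G.mul_mem hg hh)
      rw [Units.val_mul, hexp] at this
      exact this
    have h1 := (hasDerivAt_eval_mul_exp g.val A p ((0 : ℝ) : ℂ)).comp_ofReal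
    simp only [h0] at h1
    have h2 := h1.unique (hasDerivAt_const (0 : ℝ) (0 : ℂ))
    simpa using h2
  · intro hA t
    obtain ⟨S, hS⟩ := hG
    have hone : ∀ p ∈ groupIdeal G,
        eval (fun ij => (1 : Matrix (Fin n) (Fin n) ℂ) ij.1 ij.2) p = 0 :=
      fun p hp => hp 1 G.one_mem
    have hunit : IsUnit (NormedSpace.exp (t • A)) := Matrix.isUnit_exp _
    refine ⟨hunit.unit, (hS _).2 fun p hp => ?_, rfl⟩
    exact eval_exp_eq_zero hone hA (fun g hg => (hS g).1 hg p hp) (t : ℂ)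

variable {G : Subgroup (GL (Fin n) ℂ)}

theorem zero_mem_lieAlg : (0 : Matrix (Fin n) (Fin n) ℂ) ∈ lieAlg G :=
  fun t => ⟨1, G.one_mem, by simp⟩

theorem add_mem_lieAlg (hG : IsZariskiClosedSubgroup G) {A B : Matrix (Fin n) (Fin n) ℂ}
    (hA : A ∈ lieAlg G) (hB : B ∈ lieAlg G) : A + B ∈ lieAlg G := by
  rw [mem_lieAlg_iff hG] at *
  intro p hp
  rw [rightDerivation_add]
  exact add_mem (hA p hp) (hB p hp)

theorem smul_mem_lieAlg (hG : IsZariskiClosedSubgroup G) (c : ℂ) {A : Matrix (Fin n) (Fin n) ℂ}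
    (hA : A ∈ lieAlg G) : c • A ∈ lieAlg G := by
  rw [mem_lieAlg_iff hG] at *
  intro p hp
  rw [rightDerivation_smul]
  exact Submodule.smul_of_tower_mem _ c (hA p hp)

theorem commutator_mem_lieAlg (hG : IsZariskiClosedSubgroup G) {A B : Matrix (Fin n) (Fin n) ℂ}
    (hA : A ∈ lieAlg G) (hB : B ∈ lieAlg G) : A * B - B * A ∈ lieAlg G := by
  rw [mem_lieAlg_iff hG] at *
  intro p hp
  rw [rightDerivation_commutator, Derivation.commutator_apply]
  exact sub_mem (hA _ (hB p hp)) (hB _ (hA p hp))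

theorem lieAlg_compactPart_subset : lieAlg (compactPart G) ⊆ lieAlg G := by
  intro A hA t
  obtain ⟨h, hh, hexp⟩ := hA t
  exact ⟨h, hh.1, hexp⟩

attribute [local instance] Matrix.linftyOpNormedRing Matrix.linftyOpNormedAlgebra in
theorem conjTranspose_eq_neg_of_mem_lieAlg_compactPart {A : Matrix (Fin n) (Fin n) ℂ}
    (hA : A ∈ lieAlg (compactPart G)) : Aᴴ = -A := by
  have h0 : ∀ t : ℝ, NormedSpace.exp (t • Aᴴ) * NormedSpace.exp (t • A) = 1 := by
    intro t
    obtain ⟨h, hh, hexp⟩ := hA t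
    have h1 := Matrix.mem_unitaryGroup_iff'.1 hh.2
    rw [hexp, Matrix.star_eq_conjTranspose, ← Matrix.exp_conjTranspose,
      Matrix.conjTranspose_smul] at h1
    simpa using h1
  have h1 := (hasDerivAt_exp_smul_const (𝕂 := ℝ) Aᴴ 0).mul
    (hasDerivAt_exp_smul_const (𝕂 := ℝ) A 0)
  have h2 : HasDerivAt (fun _ : ℝ => (1 : Matrix (Fin n) (Fin n) ℂ))
      (NormedSpace.exp ((0 : ℝ) • Aᴴ) * Aᴴ * NormedSpace.exp ((0 : ℝ) • A) +
        NormedSpace.exp ((0 : ℝ) • Aᴴ) * (NormedSpace.exp ((0 : ℝ) • A) * A)) 0 := by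
    convert! h1 using 1
    ext1 t
    exact (h0 t).symm
  have h3 := h2.unique (hasDerivAt_const (0 : ℝ) (1 : Matrix (Fin n) (Fin n) ℂ))
  simp only [zero_smul, NormedSpace.exp_zero, one_mul, mul_one] at h3
  exact eq_neg_of_add_eq_zero_left h3

theorem mem_lieAlg_compactPart {A : Matrix (Fin n) (Fin n) ℂ} (hA : A ∈ lieAlg G)
    (hskew : Aᴴ = -A) : A ∈ lieAlg (compactPart G) := by
  intro t
  obtain ⟨h, hh, hexp⟩ := hA t
  refine ⟨h, ⟨hh, ?_⟩, hexp⟩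
  rw [Matrix.mem_unitaryGroup_iff', hexp, Matrix.star_eq_conjTranspose,
    ← Matrix.exp_conjTranspose, Matrix.conjTranspose_smul, hskew]
  have e : star t • -A = -(t • A) := by simp
  rw [e, ← Matrix.exp_add_of_commute _ _ (Commute.refl (t • A)).neg_left, neg_add_cancel,
    NormedSpace.exp_zero]

theorem sum_smul_mem_lieAlg_compactPart (hG : IsZariskiClosedSubgroup G) {ι : Type*} [Fintype ι]
    {A : ι → Matrix (Fin n) (Fin n) ℂ} (hA : ∀ j, A j ∈ lieAlg (compactPart G)) (a : ι → ℝ) :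
    ∑ j, a j • A j ∈ lieAlg (compactPart G) := by
  refine mem_lieAlg_compactPart ?_ ?_
  · refine Finset.sum_induction _ (· ∈ lieAlg G) (fun _ _ => add_mem_lieAlg hG) zero_mem_lieAlg
      fun j _ => ?_
    have h := smul_mem_lieAlg hG (a j : ℂ) (lieAlg_compactPart_subset (hA j))
    rwa [Complex.coe_smul] at h
  · rw [Matrix.conjTranspose_sum, ← Finset.sum_neg_distrib]
    refine Finset.sum_congr rfl fun j _ => ?_
    rw [Matrix.conjTranspose_smul, conjTranspose_eq_neg_of_mem_lieAlg_compactPart (hA j)]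
    simp

end LieAlgebra
/-! ### Smooth points -/

section SmoothPoints

open MvPolynomial

variable {n : ℕ}

theorem mem_idealOf_iff {X : Set (V n)} {p : MvPolynomial (Fin n) ℂ} :
    p ∈ idealOf X ↔ ∀ x ∈ X, eval x.ofLp p = 0 := by
  simp [idealOf, mem_vanishingIdeal_iff, aeval_eq_eval]

theorem mem_tangentSpace_iff {X : Set (V n)} {x w : V n} :
    w ∈ tangentSpace X x ↔ ∀ p ∈ idealOf X, ∑ i, gradAt x.ofLp p i * w i = 0 := Iff.rfl

theorem mem_iff_of_isZariskiClosed {X : Set (V n)} (hX : IsZariskiClosed X) {x : V n} :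
    x ∈ X ↔ ∀ p ∈ idealOf X, eval x.ofLp p = 0 := by
  refine ⟨fun hx p hp => mem_idealOf_iff.1 hp x hx, fun h => ?_⟩
  obtain ⟨S, rfl⟩ := hX
  exact fun p hp => h p (mem_idealOf_iff.2 fun y hy => hy p hp)

theorem contDiff_eval (p : MvPolynomial (Fin n) ℂ) {m : WithTop ℕ∞} :
    ContDiff ℝ m fun x : V n => eval x.ofLp p := by
  induction p using MvPolynomial.induction_on with
  | C c => simpa using contDiff_const
  | add p q hp hq =>
    simp only [map_add]
    exact hp.add hq
  | mul_X p i hp =>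
    simp only [map_mul, eval_X]
    exact hp.mul (EuclideanSpace.proj (𝕜 := ℂ) i |>.restrictScalars ℝ).contDiff

/-- The differential of a polynomial function at a point of `ℂⁿ`. -/
noncomputable def differentialAt (x : V n) (p : MvPolynomial (Fin n) ℂ) : V n →L[ℂ] ℂ :=
  LinearMap.toContinuousLinearMap
    { toFun := fun w => ∑ i, gradAt x.ofLp p i * w i
      map_add' := fun v w => by simp [mul_add, Finset.sum_add_distrib]
      map_smul' := fun c w => by simp [Finset.mul_sum, mul_left_comm] }

theorem differentialAt_apply (x : V n) (p : MvPolynomial (Fin n) ℂ) (w : V n) :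
    differentialAt x p w = ∑ i, gradAt x.ofLp p i * w i := rfl

theorem hasFDerivAt_eval (p : MvPolynomial (Fin n) ℂ) (x : V n) :
    HasFDerivAt (fun x : V n => eval x.ofLp p) (differentialAt x p) x := by
  induction p using MvPolynomial.induction_on with
  | C c =>
    simp only [eval_C]
    refine (hasFDerivAt_const c x).congr_fderiv (ContinuousLinearMap.ext fun w => ?_)
    simp [differentialAt_apply, gradAt_apply]
  | add p q hp hq =>
    simp only [map_add]
    refine (hp.add hq).congr_fderiv (ContinuousLinearMap.ext fun w => ?_)
    simp [differentialAt_apply, add_mul, Finset.sum_add_distrib]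
  | mul_X p j hp =>
    have h := hp.mul (EuclideanSpace.proj (𝕜 := ℂ) j : V n →L[ℂ] ℂ).hasFDerivAt
    simp only [map_mul, eval_X]
    refine h.congr_fderiv (ContinuousLinearMap.ext fun w => ?_)
    have e : ∑ i, gradAt x.ofLp (X j) i * w i = w j := by
      rw [Finset.sum_eq_single j]
      · simp [gradAt_apply]
      · intro i _ hij
        simp [gradAt_apply, pderiv_X, hij.symm]
      · simp
    simp only [differentialAt_apply, gradAt_mul, Pi.add_apply, Pi.smul_apply, smul_eq_mul, eval_X,
      add_mul, mul_assoc, Finset.sum_add_distrib, ← Finset.mul_sum, e,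
      add_apply, smul_apply, PiLp.proj_apply]

theorem continuous_gradAt (p : MvPolynomial (Fin n) ℂ) :
    Continuous fun x : V n => gradAt x.ofLp p :=
  continuous_pi fun i => (contDiff_eval (pderiv i p) (m := 0)).continuous

theorem surjective_of_linearIndependent {k : Type*} [Field k] {c : ℕ} {f : Fin c → Fin n → k}
    (hf : LinearIndependent k f) : Function.Surjective (Matrix.of f).mulVecLin := by
  have h : (Matrix.of f).rank = c := by
    rw [LinearIndependent.rank_matrix (M := Matrix.of f) hf, Fintype.card_fin]
  rw [← LinearMap.range_eq_top]
  apply Submodule.eq_top_of_finrank_eq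
  rw [Module.finrank_fin_fun]
  exact h

/-- The common kernel of `c` independent linear forms on `ℂⁿ` has dimension `n - c`. -/
theorem finrank_add_eq_of_linearIndependent {c : ℕ} {f : Fin c → Fin n → ℂ}
    (hf : LinearIndependent ℂ f) {T : Submodule ℂ (V n)}
    (hT : ∀ w, w ∈ T ↔ ∀ i, ∑ j, f i j * w j = 0) : Module.finrank ℂ T + c = n := by
  let g : V n →ₗ[ℂ] Fin c → ℂ :=
    (Matrix.of f).mulVecLin ∘ₗ (WithLp.linearEquiv 2 ℂ (Fin n → ℂ)).toLinearMap
  have hg : Function.Surjective g :=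
    (surjective_of_linearIndependent hf).comp (WithLp.linearEquiv 2 ℂ (Fin n → ℂ)).surjective
  have hker : LinearMap.ker g = T := by
    ext w
    rw [hT, LinearMap.mem_ker, funext_iff]
    rfl
  have h := g.finrank_range_add_finrank_ker
  rw [LinearMap.range_eq_top.2 hg, finrank_top, Module.finrank_fin_fun, hker,
    finrank_euclideanSpace_fin] at h
  omega

theorem trdeg_eq_dimension (X : Set (V n)) :
    Algebra.trdeg ℂ (MvPolynomial (Fin n) ℂ ⧸ idealOf X) = (dimension X : ℕ) := by
  have h : Algebra.trdeg ℂ (MvPolynomial (Fin n) ℂ ⧸ idealOf X) ≤ n := by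
    refine (trdeg_le_of_surjective (Ideal.Quotient.mkₐ ℂ (idealOf X))
      (Ideal.Quotient.mkₐ_surjective ℂ _)).trans ?_
    rw [MvPolynomial.trdeg_of_isDomain]
    simp
  exact (Cardinal.cast_toNat_of_lt_aleph0 (h.trans_lt Cardinal.natCast_lt_aleph0)).symm

/-- Local equations of a variety `X` at a smooth point `x`: as many as the codimension, with
independent gradients, cutting out near `x` both `X` and its tangent spaces. -/
theorem exists_local_equations {X : Set (V n)} (hX : IsIrreducibleVariety X) {x : V n}
    (hx : x ∈ smoothPoints X) :
    ∃ (c : ℕ) (p : Fin c → MvPolynomial (Fin n) ℂ) (U : Set (V n)),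
      dimension X + c = n ∧ IsOpen U ∧ x ∈ U ∧
      (∀ u ∈ U, u ∈ X ↔ ∀ i, eval u.ofLp (p i) = 0) ∧
      (∀ u ∈ U, u ∈ X → ∀ w, w ∈ tangentSpace X u ↔
        ∀ i, ∑ j, gradAt u.ofLp (p i) j * w j = 0) ∧
      ∀ u ∈ U, LinearIndependent ℂ fun i => gradAt u.ofLp (p i) := by
  obtain ⟨hxX, hxdim⟩ := hx
  have hprime : (idealOf X).IsPrime := hX.2
  obtain ⟨v, hv, hvspan, hvli⟩ := Submodule.exists_fun_fin_finrank_span_eq ℂ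
    (gradAt x.ofLp '' (idealOf X : Set (MvPolynomial (Fin n) ℂ)))
  choose p hpI hp using hv
  have hpv : (fun i => gradAt x.ofLp (p i)) = v := funext hp
  have hT : ∀ w, w ∈ tangentSpace X x ↔ ∀ i, ∑ j, v i j * w j = 0 := by
    intro w
    refine ⟨fun hw i => ?_, fun hw q hq => ?_⟩
    · rw [← hp]
      exact hw (p i) (hpI i)
    · have hmem : gradAt x.ofLp q ∈ Submodule.span ℂ (Set.range v) := by
        rw [hvspan]
        exact Submodule.subset_span ⟨q, hq, rfl⟩
      obtain ⟨a, ha⟩ := (Submodule.mem_span_range_iff_exists_fun ℂ).1 hmem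
      change ∑ j, gradAt x.ofLp q j * w j = 0
      rw [← ha]
      simp only [Finset.sum_apply, Pi.smul_apply, smul_eq_mul, Finset.sum_mul]
      rw [Finset.sum_comm]
      refine Finset.sum_eq_zero fun i _ => ?_
      simp only [mul_assoc]
      rw [← Finset.mul_sum, hw i, mul_zero]
  have hc := finrank_add_eq_of_linearIndependent hvli hT
  rw [hxdim] at hc
  rw [← hpv] at hvli
  obtain ⟨f, hf0, hf⟩ := exists_mul_mem_span_of_linearIndependent_gradAt x.ofLp (idealOf X)
    (fun q hq => mem_idealOf_iff.1 hq x hxX)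
    (by rw [trdeg_eq_dimension]; exact_mod_cast hc.ge) p hpI hvli
  refine ⟨_, p, {u | eval u.ofLp f ≠ 0} ∩ {u | LinearIndependent ℂ fun i => gradAt u.ofLp (p i)},
    hc, ?_, ⟨hf0, hvli⟩, ?_, ?_, fun u hu => hu.2⟩
  · refine IsOpen.inter ?_ ?_
    · exact isOpen_ne_fun (contDiff_eval f (m := 0)).continuous continuous_const
    · exact isOpen_setOfPred_linearIndependent.preimage
        (continuous_pi fun i => continuous_gradAt (p i))
  · rintro u ⟨hu, _⟩
    refine ⟨fun h i => mem_idealOf_iff.1 (hpI i) u h, fun h => ?_⟩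
    rw [mem_iff_of_isZariskiClosed hX.1]
    intro q hq
    have hle : Ideal.span (Set.range p) ≤ RingHom.ker (eval u.ofLp) := by
      rw [Ideal.span_le]
      rintro _ ⟨i, rfl⟩
      exact h i
    have h0 := hle (hf q hq)
    rw [RingHom.mem_ker, map_mul] at h0
    exact (mul_eq_zero.1 h0).resolve_left hu
  · rintro u ⟨hu, _⟩ huX w
    refine ⟨fun hw i => hw (p i) (hpI i), fun h => ?_⟩
    rw [mem_tangentSpace_iff]
    -- Differentiate the relation `f q ∈ (p₁, …, p_c)` at `u`, where `q` and the `pᵢ` vanish.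
    have key : ∀ r ∈ Ideal.span (Set.range p),
        eval u.ofLp r = 0 ∧ ∑ j, gradAt u.ofLp r j * w j = 0 := by
      intro r hr
      induction hr using Submodule.span_induction with
      | mem r hr =>
        obtain ⟨i, rfl⟩ := hr
        exact ⟨mem_idealOf_iff.1 (hpI i) u huX, h i⟩
      | zero => simp
      | add r s _ _ hr hs =>
        simp [hr.1, hs.1, hr.2, hs.2, add_mul, Finset.sum_add_distrib]
      | smul a r _ hr =>
        simp [gradAt_mul, hr.1, hr.2, mul_assoc, ← Finset.mul_sum]
    intro q hq
    have h0 := (key _ (hf q hq)).2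
    rw [gradAt_mul, mem_idealOf_iff.1 hq u huX] at h0
    simp only [zero_smul, add_zero, Pi.smul_apply, smul_eq_mul, mul_assoc] at h0
    rw [← Finset.mul_sum] at h0
    exact (mul_eq_zero.1 h0).resolve_left hu

end SmoothPoints
/-! ### Orbits and the moment map -/

section Orbits

open MvPolynomial

variable {n : ℕ} {G : Subgroup (GL (Fin n) ℂ)} {X : Set (V n)}

/-- The linear map `A ↦ A x`. -/
noncomputable def actLinear (x : V n) : Matrix (Fin n) (Fin n) ℂ →ₗ[ℂ] V n :=
  Matrix.toEuclideanLin.toLinearMap.flip x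

theorem act_add (A B : Matrix (Fin n) (Fin n) ℂ) (x : V n) :
    act (A + B) x = act A x + act B x := map_add (actLinear x) A B

theorem act_smul (c : ℂ) (A : Matrix (Fin n) (Fin n) ℂ) (x : V n) :
    act (c • A) x = c • act A x := map_smul (actLinear x) c A

theorem act_sum_smul {ι : Type*} [Fintype ι] (a : ι → ℝ) (A : ι → Matrix (Fin n) (Fin n) ℂ)
    (x : V n) : act (∑ j, a j • A j) x = ∑ j, a j • act (A j) x := by
  change ((actLinear x).restrictScalars ℝ) _ = _
  rw [map_sum]
  exact Finset.sum_congr rfl fun j _ => map_smul ((actLinear x).restrictScalars ℝ) _ _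

theorem act_mul (A B : Matrix (Fin n) (Fin n) ℂ) (x : V n) : act (A * B) x = act A (act B x) := by
  simp [act, Matrix.toLpLin_mul_same]

theorem inner_act_left (A : Matrix (Fin n) (Fin n) ℂ) (x y : V n) :
    inner ℂ (act A x) y = inner ℂ x (act Aᴴ y) := by
  rw [act, act, Matrix.toEuclideanLin_conjTranspose_eq_adjoint, LinearMap.adjoint_inner_right]

theorem inner_act_left_of_skew {A : Matrix (Fin n) (Fin n) ℂ} (hA : Aᴴ = -A) (x y : V n) :
    inner ℂ (act A x) y = -inner ℂ x (act A y) := by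
  rw [inner_act_left, hA, ← neg_one_smul ℂ A, act_smul, neg_one_smul, inner_neg_right]

theorem continuous_act (A : Matrix (Fin n) (Fin n) ℂ) : Continuous (act A) :=
  (Matrix.toEuclideanLin A).continuous_of_finiteDimensional

attribute [local instance] Matrix.linftyOpNormedRing Matrix.linftyOpNormedAlgebra in
/-- The orbit directions are tangent to an invariant set. -/
theorem act_mem_tangentSpace (hGX : ∀ g ∈ G, ∀ x ∈ X, act g.val x ∈ X)
    {A : Matrix (Fin n) (Fin n) ℂ} (hA : A ∈ lieAlg G) {u : V n} (hu : u ∈ X) :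
    act A u ∈ tangentSpace X u := by
  rw [mem_tangentSpace_iff]
  intro q hq
  let L : Matrix (Fin n) (Fin n) ℂ →L[ℝ] V n :=
    LinearMap.toContinuousLinearMap ((actLinear u).restrictScalars ℝ)
  have h1 : HasDerivAt (fun t : ℝ => act (NormedSpace.exp (t • A)) u)
      (act (NormedSpace.exp ((0 : ℝ) • A) * A) u) 0 :=
    L.hasFDerivAt.comp_hasDerivAt 0 (hasDerivAt_exp_smul_const (𝕂 := ℝ) A 0)
  rw [zero_smul, NormedSpace.exp_zero, one_mul] at h1
  have hu0 : act (NormedSpace.exp ((0 : ℝ) • A)) u = u := by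
    rw [zero_smul, NormedSpace.exp_zero]
    simp [act]
  have h2 := ((hu0.symm ▸ hasFDerivAt_eval q u :
    HasFDerivAt (fun x : V n => eval x.ofLp q) (differentialAt u q)
      (act (NormedSpace.exp ((0 : ℝ) • A)) u)).restrictScalars ℝ).comp_hasDerivAt 0 h1
  have h3 : HasDerivAt (fun _ : ℝ => (0 : ℂ)) (differentialAt u q (act A u)) 0 := by
    convert! h2 using 1
    ext1 t
    obtain ⟨g, hg, hexp⟩ := hA t
    have := mem_idealOf_iff.1 hq _ (hGX g hg u hu)
    rw [hexp] at this
    exact this.symm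
  exact h3.unique (hasDerivAt_const (0 : ℝ) (0 : ℂ))

theorem act_mem_orbitTangent {𝕜 : Type} [Field 𝕜] [Module 𝕜 (V n)] {A : Matrix (Fin n) (Fin n) ℂ}
    (hA : A ∈ lieAlg G) (x : V n) : act A x ∈ orbitTangent 𝕜 G x :=
  Submodule.subset_span ⟨A, hA, rfl⟩

theorem orbitDim_le_maxOrbitDim {x : V n} (hx : x ∈ X) : orbitDim ℂ G x ≤ maxOrbitDim G X := by
  refine le_csSup ⟨n, ?_⟩ ⟨x, hx, rfl⟩
  rintro _ ⟨y, _, rfl⟩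
  refine (Submodule.finrank_le _).trans_eq ?_
  simp

theorem exists_isOrbitFrame (H : Subgroup (GL (Fin n) ℂ)) (x : V n) :
    ∃ A : Fin (orbitDim ℝ H x) → Matrix (Fin n) (Fin n) ℂ, IsOrbitFrame H x A := by
  obtain ⟨f, hf, -, hli⟩ := Submodule.exists_fun_fin_finrank_span_eq ℝ
    {y : V n | ∃ A ∈ lieAlg H, y = act A x}
  choose A hA hfA using hf
  have e : f = fun j => act (A j) x := funext hfA
  exact ⟨A, hA, e ▸ hli⟩

/-- At a point where the moment map vanishes, `⟨Ax, Bx⟩` is real for `A, B ∈ Lie(K)`: its imaginary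
part is given by the moment map component of `[A, B]`. -/
theorem inner_act_act_comm (hG : IsZariskiClosedSubgroup G) {x : V n} (hx : x ∈ crit G X)
    {A B : Matrix (Fin n) (Fin n) ℂ} (hA : A ∈ lieAlg (compactPart G))
    (hB : B ∈ lieAlg (compactPart G)) :
    inner ℂ (act A x) (act B x) = inner ℂ (act B x) (act A x) := by
  have h := hx.2 _ (commutator_mem_lieAlg hG (lieAlg_compactPart_subset hA)
    (lieAlg_compactPart_subset hB))
  rw [sub_eq_add_neg, act_add, ← neg_one_smul ℂ (B * A), act_smul, neg_one_smul, act_mul, act_mul,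
    inner_add_left, inner_neg_left,
    inner_act_left_of_skew (conjTranspose_eq_neg_of_mem_lieAlg_compactPart hA) (act B x),
    inner_act_left_of_skew (conjTranspose_eq_neg_of_mem_lieAlg_compactPart hB) (act A x), neg_neg,
    neg_add_eq_zero] at h
  exact h.symm

/-- At a critical point `x` the real subspaces `Lie(K) x` and `i Lie(K) x` are orthogonal for the
real inner product, so that real frames of the `K`-orbit are independent over `ℂ`. -/
theorem IsOrbitFrame.linearIndependent_complex (hG : IsZariskiClosedSubgroup G) {x : V n}
    (hx : x ∈ crit G X) {d : ℕ} {A : Fin d → Matrix (Fin n) (Fin n) ℂ}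
    (hA : IsOrbitFrame (compactPart G) x A) :
    LinearIndependent ℂ fun j => act (A j) x := by
  rw [Fintype.linearIndependent_iff]
  intro c hc
  have hli := Fintype.linearIndependent_iff.1 hA.2
  let B := ∑ j, (c j).re • A j
  let C := ∑ j, (c j).im • A j
  have hB : B ∈ lieAlg (compactPart G) := sum_smul_mem_lieAlg_compactPart hG hA.1 _
  have hC : C ∈ lieAlg (compactPart G) := sum_smul_mem_lieAlg_compactPart hG hA.1 _
  have hBC : act B x + Complex.I • act C x = 0 := by
    rw [← hc, act_sum_smul, act_sum_smul, Finset.smul_sum, ← Finset.sum_add_distrib]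
    refine Finset.sum_congr rfl fun j _ => ?_
    rw [← Complex.coe_smul, ← Complex.coe_smul, smul_smul, ← add_smul, mul_comm,
      Complex.re_add_im]
  have hreal : (inner ℂ (act B x) (act C x)).im = 0 := by
    have h := inner_act_act_comm hG hx hB hC
    rw [← inner_conj_symm (act C x)] at h
    exact Complex.conj_eq_iff_im.1 h.symm
  have hB0 : act B x = 0 := by
    have h : inner ℂ (act B x) (act B x + Complex.I • act C x) = 0 := by
      rw [hBC, inner_zero_right]
    rw [inner_add_right, inner_smul_right] at h
    have hre := congrArg Complex.re h
    simp only [Complex.add_re, Complex.mul_re, Complex.I_re, Complex.I_im, hreal, zero_mul,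
      mul_zero, sub_zero, add_zero, Complex.zero_re] at hre
    exact (inner_self_eq_zero (𝕜 := ℂ)).1 (Complex.ext hre (inner_self_im (𝕜 := ℂ) _))
  have hC0 : act C x = 0 := by
    rw [hB0, zero_add] at hBC
    exact (smul_eq_zero.1 hBC).resolve_left Complex.I_ne_zero
  intro j
  have hre := hli (fun j => (c j).re) (by rw [← act_sum_smul]; exact hB0) j
  have him := hli (fun j => (c j).im) (by rw [← act_sum_smul]; exact hC0) j
  exact Complex.ext hre him

theorem card_le_orbitDim {x : V n} {d : ℕ} {A : Fin d → Matrix (Fin n) (Fin n) ℂ}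
    (hA : ∀ j, A j ∈ lieAlg G) (hli : LinearIndependent ℂ fun j => act (A j) x) :
    d ≤ orbitDim ℂ G x := by
  have h : LinearIndependent ℂ
      (fun j => (⟨act (A j) x, act_mem_orbitTangent (hA j) x⟩ : orbitTangent ℂ G x)) :=
    LinearIndependent.of_comp (orbitTangent ℂ G x).subtype hli
  have h' := h.fintype_card_le_finrank
  rwa [Fintype.card_fin] at h'

theorem orbitDim_compactPart_le (hG : IsZariskiClosedSubgroup G) {x : V n} (hx : x ∈ crit G X) :
    orbitDim ℝ (compactPart G) x ≤ orbitDim ℂ G x := by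
  obtain ⟨A, hA⟩ := exists_isOrbitFrame (compactPart G) x
  exact card_le_orbitDim (fun j => lieAlg_compactPart_subset (hA.1 j))
    (hA.linearIndependent_complex hG hx)

theorem inner_act_self_eq_zero {A : Matrix (Fin n) (Fin n) ℂ} (hA : Aᴴ = -A) {x : V n}
    (h : momentComponent A x = 0) : inner ℂ (act A x) x = 0 := by
  have h1 := inner_act_left_of_skew hA x x
  have h2 : (starRingEnd ℂ) (inner ℂ x (act A x)) = -inner ℂ x (act A x) := by
    rw [inner_conj_symm, h1]
  have hre := congrArg Complex.re h2
  simp only [Complex.conj_re, Complex.neg_re] at hre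
  rw [momentComponent, show (1 / (2 * Complex.I) : ℂ) = ((-(1 / 2) : ℝ) : ℂ) * Complex.I by
    rw [one_div, mul_inv, Complex.inv_I]; push_cast; ring, mul_assoc, Complex.re_ofReal_mul,
    Complex.I_mul_re] at h
  rw [h1, neg_eq_zero]
  exact Complex.ext (by simp only [Complex.zero_re]; linarith)
    (by simp only [Complex.zero_im]; linarith)

theorem momentComponent_eq_zero_of_mem_crit {x : V n} (hx : x ∈ crit G X)
    {A : Matrix (Fin n) (Fin n) ℂ} (hA : A ∈ lieAlg G) : momentComponent A x = 0 := by
  have h := congrArg (starRingEnd ℂ) (hx.2 A hA)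
  rw [inner_conj_symm, map_zero] at h
  rw [momentComponent, h, mul_zero, Complex.zero_re]

/-- Critical points near a critical orbit of maximal dimension.  If the `A j ∈ Lie(K)` are as many
as the largest orbit dimension, and the `A j x` are independent over `ℂ`, then these span
`Lie(G) x` over `ℂ`, so that the vanishing of `⟨A x, x⟩` for `A = A j` implies it for all `A`. -/
theorem mem_critO_of_momentComponent_eq_zero (hG : IsZariskiClosedSubgroup G)
    (hd : maxClosedOrbitDim G X = maxOrbitDim G X) {x : V n} (hx : x ∈ X)
    {A : Fin (maxClosedOrbitDim G X) → Matrix (Fin n) (Fin n) ℂ}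
    (hA : ∀ j, A j ∈ lieAlg (compactPart G)) (hli : LinearIndependent ℂ fun j => act (A j) x)
    (h0 : ∀ j, momentComponent (A j) x = 0) : x ∈ critO G X := by
  have hspan : Submodule.span ℂ (Set.range fun j => act (A j) x) = orbitTangent ℂ G x := by
    apply Submodule.eq_of_le_of_finrank_le
    · rw [Submodule.span_le]
      rintro _ ⟨j, rfl⟩
      exact act_mem_orbitTangent (lieAlg_compactPart_subset (hA j)) x
    · rw [finrank_span_eq_card hli, Fintype.card_fin, hd]
      exact orbitDim_le_maxOrbitDim hx
  have hcrit : x ∈ crit G X := by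
    refine ⟨hx, fun B hB => ?_⟩
    have hmem := act_mem_orbitTangent (𝕜 := ℂ) hB x
    rw [← hspan] at hmem
    obtain ⟨c, hc⟩ := (Submodule.mem_span_range_iff_exists_fun ℂ).1 hmem
    rw [← hc, sum_inner]
    refine Finset.sum_eq_zero fun j _ => ?_
    rw [inner_smul_left, inner_act_self_eq_zero
      (conjTranspose_eq_neg_of_mem_lieAlg_compactPart (hA j)) (h0 j), mul_zero]
  refine ⟨hcrit, le_antisymm ?_ ?_⟩
  · rw [hd]
    exact (orbitDim_compactPart_le hG hcrit).trans (orbitDim_le_maxOrbitDim hx)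
  · have h : LinearIndependent ℝ (fun j =>
        (⟨act (A j) x, act_mem_orbitTangent (hA j) x⟩ : orbitTangent ℝ (compactPart G) x)) :=
      LinearIndependent.of_comp (orbitTangent ℝ (compactPart G) x).subtype
        (hli.restrict_scalars' ℝ)
    have h' := h.fintype_card_le_finrank
    rwa [Fintype.card_fin] at h'

theorem isOpen_setOf_linearIndependent_act {d : ℕ} (A : Fin d → Matrix (Fin n) (Fin n) ℂ) :
    IsOpen {x : V n | LinearIndependent ℂ fun j => act (A j) x} :=
  isOpen_setOfPred_linearIndependent.preimage (continuous_pi fun j => continuous_act (A j))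

/-- The map `x ↦ A x` as a continuous real linear map. -/
noncomputable def actCLM (A : Matrix (Fin n) (Fin n) ℂ) : V n →L[ℝ] V n :=
  LinearMap.toContinuousLinearMap ((Matrix.toEuclideanLin A).restrictScalars ℝ)

theorem contDiff_momentComponent (A : Matrix (Fin n) (Fin n) ℂ) {m : WithTop ℕ∞} :
    ContDiff ℝ m (momentComponent A) :=
  Complex.reCLM.contDiff.comp (contDiff_const.mul (contDiff_id.inner ℂ (actCLM A).contDiff))

/-- The moment map equation: `dg_A (w) = -Im ⟪A x, w⟫`, where `⟪·, ·⟫` is linear in the second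
argument. -/
theorem fderiv_momentComponent {A : Matrix (Fin n) (Fin n) ℂ} (hA : Aᴴ = -A) (x w : V n) :
    fderiv ℝ (momentComponent A) x w = -(inner ℂ (act A x) w).im := by
  have h1 := (hasFDerivAt_id (𝕜 := ℝ) x).inner ℂ ((actCLM A).hasFDerivAt (x := x))
  have h2 := Complex.reCLM.hasFDerivAt.comp x (h1.const_mul (1 / (2 * Complex.I)))
  have h3 : fderiv ℝ (momentComponent A) x = _ := h2.fderiv
  have h4 : inner ℂ x (act A w) = -inner ℂ (act A x) w := by
    rw [inner_act_left_of_skew hA, neg_neg]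
  rw [h3]
  have h5 : (1 / (2 * Complex.I)) * (inner ℂ x (act A w) + inner ℂ w (act A x)) =
      -((inner ℂ (act A x) w).im : ℂ) := by
    rw [h4, ← inner_conj_symm w, neg_add_eq_sub, ← neg_sub, Complex.sub_conj]
    field_simp
    push_cast
    ring
  have h6 := congrArg Complex.re h5
  rw [← Complex.ofReal_neg, Complex.ofReal_re] at h6
  rw [← h6]
  rfl

/-- If `A x = ∑ aⱼ Aⱼ x ≠ 0`, then `i A x` is a tangent vector on which `∑ aⱼ dg_{Aⱼ}` is not
zero. -/
theorem linearIndependent_momentDifferential (hG : IsZariskiClosedSubgroup G)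
    (hGX : ∀ g ∈ G, ∀ x ∈ X, act g.val x ∈ X) {x : V n} (hx : x ∈ X) {d : ℕ}
    {A : Fin d → Matrix (Fin n) (Fin n) ℂ} (hA : IsOrbitFrame (compactPart G) x A) :
    LinearIndependent ℝ fun j => momentDifferential X (A j) x := by
  rw [Fintype.linearIndependent_iff]
  intro a ha
  refine Fintype.linearIndependent_iff.1 hA.2 a ?_
  have hB := sum_smul_mem_lieAlg_compactPart hG hA.1 a
  rw [← act_sum_smul]
  set B := ∑ j, a j • A j with hBdef
  have hw : Complex.I • act B x ∈ tangentSpace X x :=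
    Submodule.smul_mem _ _ (act_mem_tangentSpace hGX (lieAlg_compactPart_subset hB) hx)
  have h := LinearMap.congr_fun ha ⟨Complex.I • act B x, hw⟩
  have hj : ∀ j, momentDifferential X (A j) x ⟨Complex.I • act B x, hw⟩ =
      -(inner ℂ (act (A j) x) (Complex.I • act B x)).im := fun j =>
    fderiv_momentComponent (conjTranspose_eq_neg_of_mem_lieAlg_compactPart (hA.1 j)) x _
  have h2 : (inner ℂ (act B x) (Complex.I • act B x)).im = 0 := by
    have e : ∀ y, inner ℂ (act B x) y = ∑ j, inner ℂ (a j • act (A j) x) y := fun y => by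
      rw [← sum_inner, ← act_sum_smul]
    rw [e, Complex.im_sum]
    rw [LinearMap.sum_apply, LinearMap.zero_apply] at h
    rw [← neg_eq_zero, ← Finset.sum_neg_distrib, ← h]
    refine Finset.sum_congr rfl fun j _ => ?_
    rw [LinearMap.smul_apply, hj, ← Complex.coe_smul, inner_smul_left, Complex.conj_ofReal,
      Complex.im_ofReal_mul, smul_eq_mul, mul_neg]
  rw [inner_smul_right, Complex.I_mul_im] at h2
  exact (inner_self_eq_zero (𝕜 := ℂ)).1 (Complex.ext h2 (inner_self_im (𝕜 := ℂ) _))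

end Orbits
/-! ### The structure of the set of critical points -/

section Main

open MvPolynomial

variable {n : ℕ} {G : Subgroup (GL (Fin n) ℂ)} {X : Set (V n)}

theorem surjective_of_linearIndependent_functionals {M : Type*} [AddCommGroup M] [Module ℝ M]
    {d : ℕ} {g : Fin d → M →ₗ[ℝ] ℝ} (hg : LinearIndependent ℝ g) :
    Function.Surjective (LinearMap.pi g) := by
  rw [← LinearMap.range_eq_top]
  by_contra hne
  obtain ⟨f, hf0, hf⟩ := Submodule.exists_le_ker_of_lt_top _ (lt_top_iff_ne_top.2 hne)
  refine hf0 ((LinearMap.pi_ext' fun j => LinearMap.ext_ring ?_))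
  refine Fintype.linearIndependent_iff.1 hg (fun j => f (Pi.single j 1)) ?_ j
  ext w
  have h : f (LinearMap.pi g w) = 0 := hf ⟨w, rfl⟩
  rw [pi_eq_sum_univ' (LinearMap.pi g w), map_sum] at h
  rw [LinearMap.sum_apply, LinearMap.zero_apply, ← h]
  refine Finset.sum_congr rfl fun j _ => ?_
  rw [map_smul, LinearMap.smul_apply, LinearMap.pi_apply, smul_eq_mul, smul_eq_mul, mul_comm]

/-- The polynomials `p i` as a map into `ℂᶜ`. -/
noncomputable def polynomialMap {c : ℕ} (p : Fin c → MvPolynomial (Fin n) ℂ) (x : V n) :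
    Fin c → ℂ :=
  fun i => eval x.ofLp (p i)

theorem contDiff_polynomialMap {c : ℕ} (p : Fin c → MvPolynomial (Fin n) ℂ) {m : WithTop ℕ∞} :
    ContDiff ℝ m (polynomialMap p) :=
  contDiff_pi.2 fun i => contDiff_eval (p i)

theorem fderiv_polynomialMap {c : ℕ} (p : Fin c → MvPolynomial (Fin n) ℂ) (x w : V n) (i : Fin c) :
    fderiv ℝ (polynomialMap p) x w i = ∑ j, gradAt x.ofLp (p i) j * w j := by
  have h : HasFDerivAt (polynomialMap p)
      (ContinuousLinearMap.pi fun i => (differentialAt x (p i)).restrictScalars ℝ) x :=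
    hasFDerivAt_pi.2 fun i => (hasFDerivAt_eval (p i) x).restrictScalars ℝ
  rw [h.fderiv]
  rfl

theorem polynomialMap_eq_zero_iff {c : ℕ} {p : Fin c → MvPolynomial (Fin n) ℂ} {x : V n} :
    polynomialMap p x = 0 ↔ ∀ i, eval x.ofLp (p i) = 0 := funext_iff

/-- The functions `momentComponent (A j)` as a map into `ℝᵈ`. -/
noncomputable def momentTuple {d : ℕ} (A : Fin d → Matrix (Fin n) (Fin n) ℂ) (x : V n) :
    Fin d → ℝ :=
  fun j => momentComponent (A j) x

theorem contDiff_momentTuple {d : ℕ} (A : Fin d → Matrix (Fin n) (Fin n) ℂ) {m : WithTop ℕ∞} :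
    ContDiff ℝ m (momentTuple A) :=
  contDiff_pi.2 fun j => contDiff_momentComponent (A j)

theorem fderiv_momentTuple {d : ℕ} (A : Fin d → Matrix (Fin n) (Fin n) ℂ) (x w : V n) (j : Fin d) :
    fderiv ℝ (momentTuple A) x w j = fderiv ℝ (momentComponent (A j)) x w := by
  have h : HasFDerivAt (momentTuple A)
      (ContinuousLinearMap.pi fun j => fderiv ℝ (momentComponent (A j)) x) x :=
    hasFDerivAt_pi.2 fun j =>
      ((contDiff_momentComponent (A j) (m := 1)).differentiable (by simp) x).hasFDerivAt
  rw [h.fderiv]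
  rfl

/-- Around a smooth point `x`, the variety is straightened together with the common zero set on it
of any moment map components whose differentials at `x` are independent on the tangent space. -/
theorem exists_isSmoothChart_smoothPoints (hX : IsIrreducibleVariety X) {x : V n}
    (hx : x ∈ smoothPoints X) {d : ℕ} {A : Fin d → Matrix (Fin n) (Fin n) ℂ}
    (hA : LinearIndependent ℝ fun j => momentDifferential X (A j) x) {M U : Set (V n)}
    (hU : IsOpen U) (hxU : x ∈ U)
    (hM : ∀ u ∈ U, u ∈ M ↔ u ∈ smoothPoints X ∧ ∀ j, momentComponent (A j) u = 0) :
    ∃ (φ : OpenPartialHomeomorph (V n) (V n)) (L N : Submodule ℝ (V n)),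
      x ∈ φ.source ∧ IsSmoothChart φ ∧
      Straightens φ (smoothPoints X) L ∧ (Module.finrank ℝ L : ℤ) = 2 * dimension X ∧
      N ≤ L ∧ Straightens φ M N ∧ (Module.finrank ℝ N : ℤ) = 2 * dimension X - d := by
  obtain ⟨c, p, U', hc, hU', hxU', hpX, hpT, hpli⟩ := exists_local_equations hX hx
  have hsmooth : ∀ u ∈ U', u ∈ smoothPoints X ↔ polynomialMap p u = 0 := by
    intro u hu
    rw [polynomialMap_eq_zero_iff, ← hpX u hu]
    refine ⟨fun h => h.1, fun h => ⟨h, ?_⟩⟩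
    have := finrank_add_eq_of_linearIndependent (hpli u hu) (hpT u hu h)
    omega
  have hsurj : Function.Surjective fun w =>
      (fderiv ℝ (polynomialMap p) x w, fderiv ℝ (momentTuple A) x w) := by
    rintro ⟨y, z⟩
    obtain ⟨w, hw⟩ := surjective_of_linearIndependent (hpli x hxU') y
    obtain ⟨t, ht⟩ := surjective_of_linearIndependent_functionals hA
      (z - fderiv ℝ (momentTuple A) x (WithLp.toLp 2 w))
    have htT := (hpT x hxU' hx.1 t).1 t.2
    have h1 : fderiv ℝ (polynomialMap p) x (WithLp.toLp 2 w) = y := by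
      rw [← hw]
      ext i
      exact fderiv_polynomialMap p x _ i
    have h2 : fderiv ℝ (polynomialMap p) x (t : V n) = 0 := by
      ext i
      rw [fderiv_polynomialMap]
      exact htT i
    have h3 : fderiv ℝ (momentTuple A) x (t : V n) =
        z - fderiv ℝ (momentTuple A) x (WithLp.toLp 2 w) := by
      rw [← ht]
      ext j
      exact fderiv_momentTuple A x _ j
    refine ⟨WithLp.toLp 2 w + t, ?_⟩
    simp only [map_add, h1, h2, h3, add_zero, add_sub_cancel]
  obtain ⟨φ, L, N, hxφ, hφ, hL, hLdim, hNL, hN, hNdim⟩ := exists_isSmoothChart_straightens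
    (contDiff_polynomialMap p) (contDiff_momentTuple A) hsurj (hU'.inter hU) ⟨hxU', hxU⟩
    (Y := smoothPoints X) (M := M) (fun u hu => hsmooth u hu.1)
    (fun u hu => by rw [hM u hu.2, hsmooth u hu.1]; exact and_congr_right fun _ => funext_iff.symm)
  have hV : Module.finrank ℝ (V n) = 2 * n := by
    rw [finrank_real_of_complex, finrank_euclideanSpace_fin]
  have hW : Module.finrank ℝ (Fin c → ℂ) = 2 * c := by
    rw [finrank_real_of_complex, Module.finrank_fin_fun]
  rw [hV, hW] at hLdim hNdim
  rw [Module.finrank_fin_fun] at hNdim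
  exact ⟨φ, L, N, hxφ, hφ, hL, by rw [hLdim]; push_cast; omega, hNL, hN,
    by rw [hNdim]; push_cast; omega⟩

theorem isRealSubmanifold_smoothPoints (hX : IsIrreducibleVariety X) :
    IsRealSubmanifold (smoothPoints X) (2 * (dimension X : ℤ)) := by
  intro x hx
  obtain ⟨φ, L, N, hxφ, hφ, hL, hLdim, -⟩ := exists_isSmoothChart_smoothPoints hX hx
    (A := (Fin.elim0 : Fin 0 → Matrix (Fin n) (Fin n) ℂ)) (linearIndependent_empty_type)
    (M := smoothPoints X) isOpen_univ (Set.mem_univ x) (fun u _ => by simp)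
  exact ⟨φ, L, hxφ, hφ, hL, hLdim⟩

/-- Near `v`, moment map components from a frame of the orbit cut out the critical points. -/
theorem exists_isOpen_mem_critO_iff (hG : IsZariskiClosedSubgroup G)
    (hGX : ∀ g ∈ G, ∀ x ∈ X, act g.val x ∈ X) (hd : maxClosedOrbitDim G X = maxOrbitDim G X)
    {v : V n} (hv : v ∈ critO G X)
    {A : Fin (maxClosedOrbitDim G X) → Matrix (Fin n) (Fin n) ℂ}
    (hA : IsOrbitFrame (compactPart G) v A) :
    ∃ U : Set (V n), IsOpen U ∧ v ∈ U ∧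
      (∀ u ∈ X ∩ U, u ∈ critO G X ↔ ∀ j, momentComponent (A j) u = 0) ∧
      ∀ u ∈ X ∩ U, LinearIndependent ℝ (fun j => momentDifferential X (A j) u) := by
  refine ⟨_, isOpen_setOf_linearIndependent_act A, hA.linearIndependent_complex hG hv.1,
    fun u hu => ⟨fun h j => ?_, fun h => ?_⟩, fun u hu => ?_⟩
  · exact momentComponent_eq_zero_of_mem_crit h.1 (lieAlg_compactPart_subset (hA.1 j))
  · exact mem_critO_of_momentComponent_eq_zero hG hd hu.1 hA.1 hu.2 h
  · have hu2 : LinearIndependent ℂ fun j => act (A j) u := hu.2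
    exact linearIndependent_momentDifferential hG hGX hu.1
      ⟨hA.1, hu2.restrict_scalars' ℝ⟩

end Main
end KempfNess

theorem mainTheorem4 (n : ℕ) (G : Subgroup (GL (Fin n) ℂ))
    (hGclosed : KempfNess.IsZariskiClosedSubgroup G)
    (hGadj : KempfNess.IsSelfAdjointSubgroup G)
    (X : Set (KempfNess.V n)) (hX : KempfNess.IsIrreducibleVariety X)
    (hGX : ∀ g ∈ G, ∀ x ∈ X, KempfNess.act g.val x ∈ X)
    (hd : KempfNess.maxClosedOrbitDim G X = KempfNess.maxOrbitDim G X) :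
    KempfNess.IsRealSubmanifoldOf
      (KempfNess.critO G X ∩ KempfNess.smoothPoints X) (KempfNess.smoothPoints X)
      (2 * (KempfNess.dimension X : ℤ) - (KempfNess.maxClosedOrbitDim G X : ℤ))
      (2 * (KempfNess.dimension X : ℤ)) ∧
    ∀ v ∈ KempfNess.critO G X ∩ KempfNess.smoothPoints X,
      (∃ A : Fin (KempfNess.maxClosedOrbitDim G X) → Matrix (Fin n) (Fin n) ℂ,
        KempfNess.IsOrbitFrame (KempfNess.compactPart G) v A) ∧
      ∀ A : Fin (KempfNess.maxClosedOrbitDim G X) → Matrix (Fin n) (Fin n) ℂ,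
        KempfNess.IsOrbitFrame (KempfNess.compactPart G) v A →
        ∃ U : Set (KempfNess.V n), IsOpen U ∧ v ∈ U ∧
          (∀ u ∈ KempfNess.smoothPoints X ∩ U,
            u ∈ KempfNess.critO G X ↔ ∀ j, KempfNess.momentComponent (A j) u = 0) ∧
          ∀ u ∈ KempfNess.critO G X ∩ KempfNess.smoothPoints X ∩ U,
            LinearIndependent ℝ (fun j => KempfNess.momentDifferential X (A j) u) := by
  have hframe : ∀ v ∈ KempfNess.critO G X,
      ∃ A : Fin (KempfNess.maxClosedOrbitDim G X) → Matrix (Fin n) (Fin n) ℂ,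
        KempfNess.IsOrbitFrame (KempfNess.compactPart G) v A := by
    intro v hv
    rw [← hv.2]
    exact KempfNess.exists_isOrbitFrame _ v
  refine ⟨⟨KempfNess.isRealSubmanifold_smoothPoints hX, Set.inter_subset_right, fun v hv => ?_⟩,
    fun v hv => ⟨hframe v hv.1, fun A hA => ?_⟩⟩
  · obtain ⟨A, hA⟩ := hframe v hv.1
    obtain ⟨U, hU, hvU, hiff, hli⟩ :=
      KempfNess.exists_isOpen_mem_critO_iff hGclosed hGX hd hv.1 hA
    refine KempfNess.exists_isSmoothChart_smoothPoints hX hv.2 (hli v ⟨hv.2.1, hvU⟩) hU hvU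
      fun u hu => ⟨fun h => ⟨h.2, (hiff u ⟨h.2.1, hu⟩).1 h.1⟩,
        fun h => ⟨(hiff u ⟨h.1.1, hu⟩).2 h.2, h.1⟩⟩
  · obtain ⟨U, hU, hvU, hiff, hli⟩ :=
      KempfNess.exists_isOpen_mem_critO_iff hGclosed hGX hd hv.1 hA
    exact ⟨U, hU, hvU, fun u hu => hiff u ⟨hu.1.1, hu.2⟩, fun u hu => hli u ⟨hu.1.2.1, hu.2⟩⟩
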